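/- Let $\tau\in\mathbb{C}$ with $\operatorname{Im}\tau>0$, and write $q^r:=e^{2\pi i r\tau}$ for $r\in\mathbb{R}$, $q:=q^1$. For $n\ge 0$ let $(x;q)_n:=\prod_{k=0}^{n-1}(1-xq^k)$, for $n<0$ let $\frac{1}{(x;q)_n}:=(q^nx;q)_{-n}$, and let $(x;q):=\prod_{k\ge0}(1-xq^k)$, $\langle x;q\rangle:=(x;q)(q/x;q)$. Let $$\eta(\tau):=e^{\pi i\tau/12}(q;q),\qquad \mathrm{E}_g(\tau):=e^{5B(g/5)\pi i\tau}\langle q^g;q^5\rangle,\qquad B(t):=t^2-t+\tfrac16,$$ be the Dedekind eta function and the generalized Dedekind eta functions of level $5$. Define the third-order mock theta functions $$\phi(q):=\sum_{n\ge0}\frac{q^{n^2}}{(-q^2;q^2)_n},\qquad \psi(q):=\sum_{n\ge1}\frac{q^{n^2}}{(q;q^2)_n},$$ and the fifth-order mock theta functions $$f_0(q):=\sum_{n\ge0}\frac{q^{n^2}}{(-q;q)_n},\quad f_1(q):=\sum_{n\ge0}\frac{q^{n^2+n}}{(-q;q)_n},\quad \psi_0(q):=\sum_{n\ge1}q^{\binom{n+1}{2}}(-q;q)_{n-1},\quad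 \psi_1(q):=\sum_{n\ge0}q^{\binom{n+1}{2}}(-q;q)_{n},$$ $$F_0(q):=\sum_{n\ge0}\frac{q^{2n^2}}{(q;q^2)_n},\quad F_1(q):=\sum_{n\ge1}\frac{q^{2n^2-2n}}{(q;q^2)_n},\quad \phi_0(q):=\sum_{n\ge0}q^{n^2}(-q;q^2)_n,\quad \phi_1(q):=\sum_{n\ge1}q^{n^2}(-q;q^2)_{n-1}.$$ Then all the series involved converge absolutely, and $$\phi(q)+2\sum_{n\ge1}q^n(-q^2;q^2)_{n-1}=\sum_{n\in\mathbb{Z}}\frac{q^{n^2}}{(-q^2;q^2)_n}=q^{\frac1{24}}\frac{\eta(2\tau)^7}{\eta(\tau)^3\eta(4\tau)^3},$$ $$1+2\psi(q)+q\sum_{n\ge0}(-q^2)^n(q;q^2)_n=\sum_{n\in\mathbb{Z}}\frac{q^{n^2}}{(q;q^2)_{n+1}}=q^{\frac1{24}}\frac{\eta(2\tau)^7}{\eta(\tau)^3\eta(4\tau)^3},$$ $$f_0(q)+2\psi_0(q)=\sum_{n\in\mathbb{Z}}\frac{q^{n^2}}{(-q;q)_n}=q^{\frac1{60}}\left(\frac{\eta(\tau)^2}{\eta(2\tau)\mathrm{E}_1(\tau)}+4\frac{\eta(4\tau)^2}{\eta(2\tau)\mathrm{E}_2(4\tau)}\right),$$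 $$f_1(q)+2\psi_1(q)=\sum_{n\in\mathbb{Z}}\frac{q^{n^2+n}}{(-q;q)_n}=q^{-\frac{11}{60}}\left(-\frac{\eta(\tau)^2}{\eta(2\tau)\mathrm{E}_2(\tau)}+4\frac{\eta(4\tau)^2}{\eta(2\tau)\mathrm{E}_1(4\tau)}\right),$$ $$F_0(q)+\phi_0(-q)-1=\sum_{n\in\mathbb{Z}}\frac{q^{2n^2}}{(q;q^2)_n}=q^{\frac1{120}}\left(\frac{\eta(4\tau)^6}{\eta(\tau)\eta(2\tau)^2\eta(8\tau)^2\mathrm{E}_1(8\tau)}+2\frac{\eta(2\tau)^4\eta(8\tau)^4}{\eta(\tau)\eta(4\tau)^6\mathrm{E}_2(2\tau)}-4\frac{\eta(2\tau)^2\eta(8\tau)^6}{\eta(\tau)\eta(4\tau)^6\mathrm{E}_1(8\tau)}\right),$$ $$F_1(q)-q^{-1}\phi_1(-q)=\sum_{n\in\mathbb{Z}}\frac{q^{2n^2-2n}}{(q;q^2)_n}=q^{-\frac{71}{120}}\left(-\frac{\eta(4\tau)^6}{\eta(\tau)\eta(2\tau)^2\eta(8\tau)^2\mathrm{E}_2(8\tau)}+2\frac{\eta(2\tau)^4\eta(8\tau)^4}{\eta(\tau)\eta(4\tau)^6\mathrm{E}_1(2\tau)}+4\frac{\eta(2\tau)^2\eta(8\tau)^6}{\eta(\tau)\eta(4\tau)^6\mathrm{E}_2(8\tau)}\right).$$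 -/

import Mathlib

noncomputable section

namespace MockTheta

/-- The power `q ^ r = exp (2 π i r τ)` for real `r`, where `q = exp (2 π i τ)`. -/
def qPow (τ : ℂ) (r : ℝ) : ℂ := Complex.exp (2 * Real.pi * Complex.I * r * τ)

/-- The finite product `(x; q)_n = ∏_{k=0}^{n-1} (1 - x q^k)` for `n ≥ 0`. -/
def qPoch (x q : ℂ) (n : ℕ) : ℂ := ∏ k ∈ Finset.range n, (1 - x * q ^ k)

/-- The quantity `1 / (x; q)_n` for all integers `n`; for `n < 0` the convention is
`1 / (x; q)_n = (q^n x; q)_{-n}`. -/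
def qPochInv (x q : ℂ) (n : ℤ) : ℂ :=
  if 0 ≤ n then 1 / qPoch x q n.toNat else qPoch (q ^ n * x) q (-n).toNat

/-- The infinite product `(x; q) = ∏_{k ≥ 0} (1 - x q^k)`, for `|q| < 1`. -/
def qPochInf (x q : ℂ) : ℂ := ∏' k : ℕ, (1 - x * q ^ k)

/-- The infinite product defining `(x; q)` converges when `|q| < 1`. -/
theorem multipliable_qPochInf (x : ℂ) {q : ℂ} (hq : ‖q‖ < 1) :
    Multipliable fun k : ℕ => 1 - x * q ^ k := by
  have h : Summable fun k : ℕ => ‖-(x * q ^ k)‖ := by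
    simpa [norm_mul, norm_pow] using
      (summable_geometric_of_lt_one (norm_nonneg q) hq).mul_left ‖x‖
  simpa [sub_eq_add_neg] using multipliable_one_add_of_summable h

/-- The modified theta function `⟨x; q⟩ = (x; q) (q / x; q)`. -/
def modTheta (x q : ℂ) : ℂ := qPochInf x q * qPochInf (q / x) q

/-- The polynomial `B(t) = t² - t + 1/6`. -/
def bernB (t : ℝ) : ℝ := t ^ 2 - t + 1 / 6

/-- The generalized Dedekind eta function of level `N`,
`E_g(τ) = exp (N B(g/N) π i τ) ⟨q^g; q^N⟩`, where `q = exp (2 π i τ)`. -/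
def genEta (N : ℕ) (g : ℤ) (τ : ℂ) : ℂ :=
  Complex.exp (((N * bernB (g / N) : ℝ) : ℂ) * Real.pi * Complex.I * τ) *
    modTheta (qPow τ 1 ^ g) (qPow τ 1 ^ N)

/-! Summands of the mock theta functions, as functions of `q` and of the summation index.
A sum over `n ≥ 1` is indexed by `m = n - 1 ≥ 0`. -/

/-- Summand of the third-order `φ(q) = ∑_{n ≥ 0} q^{n²} / (-q²; q²)_n`. -/
def phiTerm (q : ℂ) (n : ℕ) : ℂ := q ^ (n ^ 2) / qPoch (-q ^ 2) (q ^ 2) n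

/-- Summand of the third-order `ψ(q) = ∑_{n ≥ 1} q^{n²} / (q; q²)_n`, with `n = m + 1`. -/
def psiTerm (q : ℂ) (m : ℕ) : ℂ := q ^ ((m + 1) ^ 2) / qPoch q (q ^ 2) (m + 1)

/-- Summand of the fifth-order `f₀(q) = ∑_{n ≥ 0} q^{n²} / (-q; q)_n`. -/
def fZeroTerm (q : ℂ) (n : ℕ) : ℂ := q ^ (n ^ 2) / qPoch (-q) q n

/-- Summand of the fifth-order `f₁(q) = ∑_{n ≥ 0} q^{n² + n} / (-q; q)_n`. -/
def fOneTerm (q : ℂ) (n : ℕ) : ℂ := q ^ (n ^ 2 + n) / qPoch (-q) q n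

/-- Summand of the fifth-order `ψ₀(q) = ∑_{n ≥ 1} q^{n(n+1)/2} (-q; q)_{n-1}`,
with `n = m + 1`. -/
def psiZeroTerm (q : ℂ) (m : ℕ) : ℂ := q ^ ((m + 2).choose 2) * qPoch (-q) q m

/-- Summand of the fifth-order `ψ₁(q) = ∑_{n ≥ 0} q^{n(n+1)/2} (-q; q)_n`. -/
def psiOneTerm (q : ℂ) (n : ℕ) : ℂ := q ^ ((n + 1).choose 2) * qPoch (-q) q n

/-- Summand of the fifth-order `F₀(q) = ∑_{n ≥ 0} q^{2n²} / (q; q²)_n`. -/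
def FZeroTerm (q : ℂ) (n : ℕ) : ℂ := q ^ (2 * n ^ 2) / qPoch q (q ^ 2) n

/-- Summand of the fifth-order `F₁(q) = ∑_{n ≥ 1} q^{2n² - 2n} / (q; q²)_n`, with `n = m + 1`,
so that `2n² - 2n = 2m(m+1)`. -/
def FOneTerm (q : ℂ) (m : ℕ) : ℂ := q ^ (2 * m * (m + 1)) / qPoch q (q ^ 2) (m + 1)

/-- Summand of the fifth-order `φ₀(q) = ∑_{n ≥ 0} q^{n²} (-q; q²)_n`. -/
def phiZeroTerm (q : ℂ) (n : ℕ) : ℂ := q ^ (n ^ 2) * qPoch (-q) (q ^ 2) n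

/-- Summand of the fifth-order `φ₁(q) = ∑_{n ≥ 1} q^{n²} (-q; q²)_{n-1}`, with `n = m + 1`. -/
def phiOneTerm (q : ℂ) (m : ℕ) : ℂ := q ^ ((m + 1) ^ 2) * qPoch (-q) (q ^ 2) m

/-- The third-order mock theta function `φ`. -/
def phi (q : ℂ) : ℂ := ∑' n : ℕ, phiTerm q n

/-- The third-order mock theta function `ψ`. -/
def psi (q : ℂ) : ℂ := ∑' m : ℕ, psiTerm q m

/-- The fifth-order mock theta function `f₀`. -/
def fZero (q : ℂ) : ℂ := ∑' n : ℕ, fZeroTerm q n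

/-- The fifth-order mock theta function `f₁`. -/
def fOne (q : ℂ) : ℂ := ∑' n : ℕ, fOneTerm q n

/-- The fifth-order mock theta function `ψ₀`. -/
def psiZero (q : ℂ) : ℂ := ∑' m : ℕ, psiZeroTerm q m

/-- The fifth-order mock theta function `ψ₁`. -/
def psiOne (q : ℂ) : ℂ := ∑' n : ℕ, psiOneTerm q n

/-- The fifth-order mock theta function `F₀`. -/
def FZero (q : ℂ) : ℂ := ∑' n : ℕ, FZeroTerm q n

/-- The fifth-order mock theta function `F₁`. -/
def FOne (q : ℂ) : ℂ := ∑' m : ℕ, FOneTerm q m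

/-- The fifth-order mock theta function `φ₀`. -/
def phiZero (q : ℂ) : ℂ := ∑' n : ℕ, phiZeroTerm q n

/-- The fifth-order mock theta function `φ₁`. -/
def phiOne (q : ℂ) : ℂ := ∑' m : ℕ, phiOneTerm q m

end MockTheta

end

open MockTheta
open ModularForm (eta)

open MockTheta
open ModularForm (eta)

namespace MockTheta

open Filter Topology

/-! For n of either sign, 1/(x;p)_n = (x p^n;p)/(x;p) (`qPochInv_eq`). Reversing the finite product
at negative n turns that half of each bilateral series into the second one-sided series
(`qPochInv_neg_self`, `qPochInv_odd`). It remains to evaluate series of the shape ∑ q^(quadratic in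
n) z^n (b q^n; q) over ℤ. Euler's expansion of (b q^n; q) makes this a double sum with a quadratic
exponent in (n, k), which a shear of the index lattice separates.

For the third-order series the shear n ↦ n + k separates everything: a theta series times 1/(-b/z;
q), that is `hasSum_one_psi_one`. Jacobi's triple product is the case b = q of the same formula.

For the fifth-order series the square is completed differently for even and odd k. The result is θ·A
- b·θ'·B, where A and B are one-sided sums with denominators (q;q)_{2j} and (q;q)_{2j+1}
(`hasSum_two_psi_two`). In each case used, one of A, B is a sum of Rogers, equal to a
Rogers–Ramanujan series at q^4 over (q;q^2) (`hasSum_rogers_even`, `hasSum_rogers_odd`). The other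
comes from specializing to b = q: the terms with n < 0 vanish, the left side is (q;q) times a
Rogers–Ramanujan series, and the unknown sum is solved for (`hasSum_square_even`,
`hasSum_pronic_odd`). Changing b to -q keeps A and B and flips one sign, which gives f₀ and f₁; base
q^2 with b = q or q^3 gives F₀ and F₁.

The Rogers–Ramanujan identities, which turn these series into the functions E_g, are proved by a
Bailey-type argument: a finite pentagonal expansion of 1/(q;q)_N (`pentU_eq`, `pentV_eq`) is summed
against q^(N²) or q^(N²+N) by `hasSum_cauchy`, and the resulting theta series is factored by
`jacobi_triple`. -/

/-! ### Infinite q-products. -/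

lemma summable_norm_mul_pow (x : ℂ) {q : ℂ} (hq : ‖q‖ < 1) :
    Summable fun k : ℕ => ‖-(x * q ^ k)‖ := by
  simpa [norm_mul, norm_pow] using
    (summable_geometric_of_lt_one (norm_nonneg q) hq).mul_left ‖x‖

lemma qPochInf_ne_zero {x q : ℂ} (hq : ‖q‖ < 1) (h : ∀ k : ℕ, x * q ^ k ≠ 1) :
    qPochInf x q ≠ 0 := by
  unfold qPochInf
  simp only [sub_eq_add_neg]
  refine tprod_one_add_ne_zero_of_summable (f := fun k : ℕ => -(x * q ^ k)) ?_ ?_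
  · intro k hk
    exact h k (by linear_combination -hk)
  · exact summable_norm_mul_pow x hq

lemma mul_pow_ne_one {x q : ℂ} (hq : ‖q‖ < 1) (hx : ‖x‖ < 1) (k : ℕ) : x * q ^ k ≠ 1 := by
  intro hk
  have h1 : ‖x * q ^ k‖ < 1 := by
    rw [norm_mul, norm_pow]
    calc ‖x‖ * ‖q‖ ^ k ≤ ‖x‖ * 1 := by gcongr; exact pow_le_one₀ (norm_nonneg _) hq.le
      _ < 1 := by simpa using hx
  rw [hk] at h1
  simp at h1

lemma qPochInf_ne_zero_of_norm_lt {x q : ℂ} (hq : ‖q‖ < 1) (hx : ‖x‖ < 1) :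
    qPochInf x q ≠ 0 :=
  qPochInf_ne_zero hq (mul_pow_ne_one hq hx)

lemma qPoch_mul_qPochInf (x : ℂ) {q : ℂ} (hq : ‖q‖ < 1) (n : ℕ) :
    qPoch x q n * qPochInf (x * q ^ n) q = qPochInf x q := by
  have h2 : Multipliable fun k : ℕ => 1 - x * q ^ (k + n) :=
    (multipliable_qPochInf (x * q ^ n) hq).congr fun k => by ring
  have h3 := Multipliable.prod_mul_tprod_nat_mul' (f := fun k : ℕ => 1 - x * q ^ k) (k := n) h2
  have h4 : qPochInf (x * q ^ n) q = ∏' k : ℕ, (1 - x * q ^ (k + n)) :=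
    tprod_congr fun k => by ring
  rw [h4]
  exact h3

lemma qPochInf_step (x : ℂ) {q : ℂ} (hq : ‖q‖ < 1) :
    qPochInf x q = (1 - x) * qPochInf (x * q) q := by
  have := qPoch_mul_qPochInf x hq 1
  simpa [qPoch] using this.symm

lemma tendsto_qPoch (x : ℂ) {q : ℂ} (hq : ‖q‖ < 1) :
    Tendsto (qPoch x q) atTop (𝓝 (qPochInf x q)) :=
  (multipliable_qPochInf x hq).hasProd.tendsto_prod_nat

lemma qPochInf_mul_neg (x : ℂ) {q : ℂ} (hq : ‖q‖ < 1) :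
    qPochInf x q * qPochInf (-x) q = qPochInf (x ^ 2) (q ^ 2) := by
  unfold qPochInf
  rw [← (multipliable_qPochInf x hq).tprod_mul (multipliable_qPochInf (-x) hq)]
  refine tprod_congr fun k => ?_
  ring

lemma norm_pow_lt_one {q : ℂ} (hq : ‖q‖ < 1) {m : ℕ} (hm : m ≠ 0) : ‖q ^ m‖ < 1 := by
  rw [norm_pow]
  exact pow_lt_one₀ (norm_nonneg _) hq hm

/-- Splitting `(x; q)` according to residues of the exponent modulo `m`. -/
lemma prod_qPochInf_residues (x : ℂ) {q : ℂ} (hq : ‖q‖ < 1) {m : ℕ} (hm : m ≠ 0) :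
    ∏ i ∈ Finset.range m, qPochInf (x * q ^ i) (q ^ m) = qPochInf x q := by
  have h1 : Tendsto (fun N => ∏ i ∈ Finset.range m, qPoch (x * q ^ i) (q ^ m) N) atTop
      (𝓝 (∏ i ∈ Finset.range m, qPochInf (x * q ^ i) (q ^ m))) :=
    tendsto_finsetProd _ fun i _ => tendsto_qPoch _ (norm_pow_lt_one hq hm)
  have h2 : Tendsto (fun N => qPoch x q (N * m)) atTop (𝓝 (qPochInf x q)) :=
    (tendsto_qPoch x hq).comp (tendsto_id.atTop_mul_const' (Nat.pos_of_ne_zero hm))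
  refine tendsto_nhds_unique h1 (h2.congr fun N => ?_)
  induction N with
  | zero => simp [qPoch]
  | succ N ih =>
    have h3 : qPoch x q ((N + 1) * m) =
        qPoch x q (N * m) * ∏ i ∈ Finset.range m, (1 - x * q ^ (N * m + i)) := by
      unfold qPoch
      rw [add_mul, one_mul, Finset.prod_range_add]
    rw [h3, ih, ← Finset.prod_mul_distrib]
    refine Finset.prod_congr rfl fun i _ => ?_
    unfold qPoch
    rw [Finset.prod_range_succ]
    ring

lemma qPoch_succ (x q : ℂ) (n : ℕ) : qPoch x q (n + 1) = qPoch x q n * (1 - x * q ^ n) := by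
  unfold qPoch
  rw [Finset.prod_range_succ]

lemma qPoch_zero (x q : ℂ) : qPoch x q 0 = 1 := by simp [qPoch]

lemma qPoch_ne_zero {x q : ℂ} (h : ∀ k : ℕ, x * q ^ k ≠ 1) (n : ℕ) : qPoch x q n ≠ 0 := by
  unfold qPoch
  exact Finset.prod_ne_zero_iff.mpr fun k _ => sub_ne_zero.mpr (h k).symm

/-! ### Euler's two expansions. -/

/-- The coefficient `1 / (q; q)_k`. -/
noncomputable def qc (q : ℂ) (k : ℕ) : ℂ := (qPoch q q k)⁻¹

lemma qc_zero (q : ℂ) : qc q 0 = 1 := by simp [qc, qPoch]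

lemma one_sub_pow_ne_zero {q : ℂ} (hq : ‖q‖ < 1) (k : ℕ) : 1 - q ^ (k + 1) ≠ 0 := by
  have := mul_pow_ne_one hq hq k
  rw [sub_ne_zero, pow_succ']
  exact this.symm

lemma qc_succ {q : ℂ} (hq : ‖q‖ < 1) (k : ℕ) : (1 - q ^ (k + 1)) * qc q (k + 1) = qc q k := by
  unfold qc
  rw [qPoch_succ, ← pow_succ', mul_inv, mul_comm, mul_assoc,
    inv_mul_cancel₀ (one_sub_pow_ne_zero hq k), mul_one]

lemma qc_ne_zero {q : ℂ} (hq : ‖q‖ < 1) (k : ℕ) : qc q k ≠ 0 :=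
  inv_ne_zero (qPoch_ne_zero (mul_pow_ne_one hq hq) k)

lemma exists_norm_qc_le {q : ℂ} (hq : ‖q‖ < 1) : ∃ M : ℝ, 0 ≤ M ∧ ∀ k, ‖qc q k‖ ≤ M := by
  have h := (tendsto_qPoch q hq).inv₀ (qPochInf_ne_zero_of_norm_lt hq hq)
  obtain ⟨M, hM⟩ := (Metric.isBounded_range_of_tendsto _ h).exists_norm_le
  exact ⟨M, (norm_nonneg _).trans (hM _ ⟨0, rfl⟩), fun k => hM _ ⟨k, rfl⟩⟩

lemma summable_euler_one {q : ℂ} (hq : ‖q‖ < 1) {x : ℂ} (hx : ‖x‖ < 1) :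
    Summable fun k : ℕ => ‖x ^ k * qc q k‖ := by
  obtain ⟨M, hM, h⟩ := exists_norm_qc_le hq
  refine Summable.of_nonneg_of_le (fun _ => norm_nonneg _) (fun k => ?_)
    ((summable_geometric_of_lt_one (norm_nonneg x) hx).mul_right M)
  rw [norm_mul, norm_pow]
  gcongr
  exact h k

/-- Dominated convergence: only the constant term survives as x q^n → 0. This supplies the limit
that ends the iteration of a q-difference equation. -/
lemma tsum_tendsto_of_mul_pow {q : ℂ} (hq : ‖q‖ < 1) (a : ℕ → ℂ) (x : ℂ)
    (ha : Summable fun k => ‖x ^ k * a k‖) :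
    Tendsto (fun n : ℕ => ∑' k : ℕ, (x * q ^ n) ^ k * a k) atTop (𝓝 (a 0)) := by
  have h0 : a 0 = ∑' k : ℕ, if k = 0 then a 0 else 0 := by
    rw [tsum_ite_eq]
  rw [h0]
  refine tendsto_tsum_of_dominated_convergence ha (fun k => ?_) (Eventually.of_forall fun n k => ?_)
  · rcases Nat.eq_zero_or_pos k with rfl | hk
    · simp
    · rw [if_neg hk.ne']
      have : Tendsto (fun n : ℕ => (q ^ k) ^ n * (x ^ k * a k)) atTop (𝓝 (0 * (x ^ k * a k))) :=
        (tendsto_pow_atTop_nhds_zero_of_norm_lt_one (norm_pow_lt_one hq hk.ne')).mul_const _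
      rw [zero_mul] at this
      refine this.congr fun n => ?_
      rw [mul_pow, ← pow_mul, ← pow_mul, mul_comm k n]
      ring
  · rw [mul_pow, mul_assoc, mul_left_comm, norm_mul]
    have : ‖(q ^ n) ^ k‖ ≤ 1 := by
      rw [norm_pow, norm_pow]
      exact pow_le_one₀ (by positivity) (pow_le_one₀ (norm_nonneg _) hq.le)
    exact mul_le_of_le_one_left (norm_nonneg _) this

/-- The series G(y) satisfies (1 - y) G(y) = G(y q), because (1 - q^k)/(q;q)_k = 1/(q;q)_{k-1}.
Iterating gives (x;q)_n G(x) = G(x q^n), and the right side tends to 1. -/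
lemma euler_one {q : ℂ} (hq : ‖q‖ < 1) {x : ℂ} (hx : ‖x‖ < 1) :
    HasSum (fun k : ℕ => x ^ k * qc q k) (qPochInf x q)⁻¹ := by
  have hs : ∀ y : ℂ, ‖y‖ < 1 → Summable fun k : ℕ => y ^ k * qc q k := fun y hy =>
    (summable_euler_one hq hy).of_norm
  have step : ∀ y : ℂ, ‖y‖ < 1 →
      (1 - y) * ∑' k : ℕ, y ^ k * qc q k = ∑' k : ℕ, (y * q) ^ k * qc q k := by
    intro y hy
    have hyq : ‖y * q‖ < 1 := by
      rw [norm_mul]; exact mul_lt_one_of_nonneg_of_lt_one_left (norm_nonneg _) hy hq.le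
    rw [sub_mul, one_mul, sub_eq_iff_eq_add, ← sub_eq_iff_eq_add', ← (hs y hy).tsum_sub (hs _ hyq),
      ((hs y hy).sub (hs _ hyq)).tsum_eq_zero_add, ← tsum_mul_left]
    simp only [pow_zero, sub_self, zero_add]
    refine tsum_congr fun k => ?_
    rw [← qc_succ hq k]
    ring
  have iter : ∀ n : ℕ, qPoch x q n * ∑' k : ℕ, x ^ k * qc q k =
      ∑' k : ℕ, (x * q ^ n) ^ k * qc q k := by
    intro n
    induction n with
    | zero => simp [qPoch]
    | succ n ih =>
      have hn : ‖x * q ^ n‖ < 1 := by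
        rw [norm_mul, norm_pow]
        exact mul_lt_one_of_nonneg_of_lt_one_left (norm_nonneg _) hx
          (pow_le_one₀ (norm_nonneg _) hq.le)
      rw [qPoch_succ, mul_right_comm, ih, mul_comm, step _ hn, mul_assoc, ← pow_succ]
  have h1 := tsum_tendsto_of_mul_pow hq (qc q) x (summable_euler_one hq hx)
  have h2 := (tendsto_qPoch x hq).mul_const (∑' k : ℕ, x ^ k * qc q k)
  have h3 := tendsto_nhds_unique h2 (h1.congr fun n => (iter n).symm)
  rw [qc_zero] at h3
  rw [(hs x hx).hasSum_iff]
  exact eq_inv_of_mul_eq_one_right h3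

lemma summable_euler_two {s : ℂ} (hs0 : s ≠ 0) (hs : ‖s‖ < 1) (x : ℂ) :
    Summable fun k : ℕ => ‖x ^ k * (s ^ ((k : ℤ) ^ 2 - k) * qc (s ^ 2) k)‖ := by
  rcases eq_or_ne x 0 with rfl | hx
  · refine summable_of_ne_finset_zero (s := {0}) fun k hk => ?_
    simp at hk
    simp [hk]
  obtain ⟨M, hM, h⟩ := exists_norm_qc_le (norm_pow_lt_one hs two_ne_zero)
  have h1 : Summable fun k : ℕ => x ^ k * s ^ ((k : ℤ) ^ 2 - k) := by
    refine summable_of_ratio_test_tendsto_lt_one zero_lt_one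
      (Eventually.of_forall fun k => mul_ne_zero (pow_ne_zero _ hx) (zpow_ne_zero _ hs0)) ?_
    have : Tendsto (fun k : ℕ => ‖x‖ * (‖s ^ 2‖) ^ k) atTop (𝓝 (‖x‖ * 0)) :=
      (tendsto_pow_atTop_nhds_zero_of_lt_one (norm_nonneg _)
        (norm_pow_lt_one hs two_ne_zero)).const_mul _
    rw [mul_zero] at this
    refine this.congr fun k => ?_
    rw [eq_div_iff (norm_ne_zero_iff.mpr (mul_ne_zero (pow_ne_zero _ hx) (zpow_ne_zero _ hs0))),
      ← norm_pow, ← norm_mul, ← norm_mul]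
    congr 1
    have : ((k + 1 : ℕ) : ℤ) ^ 2 - (k + 1 : ℕ) = ((k : ℤ) ^ 2 - k) + ((2 * k : ℕ) : ℤ) := by
      push_cast; ring
    rw [this, zpow_add₀ hs0, zpow_natCast]
    ring
  refine Summable.of_nonneg_of_le (fun _ => norm_nonneg _) (fun k => ?_) (h1.norm.mul_right M)
  rw [← mul_assoc, norm_mul]
  gcongr
  exact h k

/-- The base is written s² so that q^(k(k-1)/2) becomes the integral power s^(k²-k). The series at
-x satisfies the same first-order q-difference equation as the product, and iteration down to 0
identifies them. -/
lemma euler_two {s : ℂ} (hs0 : s ≠ 0) (hs : ‖s‖ < 1) (x : ℂ) :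
    HasSum (fun k : ℕ => (-1) ^ k * s ^ ((k : ℤ) ^ 2 - k) * x ^ k * qc (s ^ 2) k)
      (qPochInf x (s ^ 2)) := by
  have hq := norm_pow_lt_one hs two_ne_zero
  set a : ℕ → ℂ := fun k => (s ^ ((k : ℤ) ^ 2 - k) * qc (s ^ 2) k) with ha
  have hsn := summable_euler_two hs0 hs
  have hsm : ∀ y : ℂ, Summable fun k : ℕ => y ^ k * a k := fun y => (hsn y).of_norm
  have step : ∀ y : ℂ, (∑' k : ℕ, y ^ k * a k) = (1 + y) * ∑' k : ℕ, (y * s ^ 2) ^ k * a k := by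
    intro y
    rw [add_mul, one_mul, ← sub_eq_iff_eq_add', ← (hsm y).tsum_sub (hsm _),
      ((hsm y).sub (hsm _)).tsum_eq_zero_add, ← tsum_mul_left]
    simp only [pow_zero, sub_self, zero_add]
    refine tsum_congr fun k => ?_
    simp only [ha]
    rw [← qc_succ hq k]
    have : ((k + 1 : ℕ) : ℤ) ^ 2 - (k + 1 : ℕ) = ((k : ℤ) ^ 2 - k) + ((2 * k : ℕ) : ℤ) := by
      push_cast; ring
    rw [this, zpow_add₀ hs0, zpow_natCast]
    ring
  have iter : ∀ n : ℕ, ∑' k : ℕ, (-x) ^ k * a k =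
      qPoch x (s ^ 2) n * ∑' k : ℕ, (-x * (s ^ 2) ^ n) ^ k * a k := by
    intro n
    induction n with
    | zero => simp [qPoch]
    | succ n ih =>
      rw [ih, qPoch_succ, step]
      simp only [pow_succ (s ^ 2) n, ← mul_assoc]
      ring
  have h1 := tsum_tendsto_of_mul_pow hq a (-x) (hsn (-x))
  have h2 := (tendsto_qPoch x hq).mul h1
  have h3 := tendsto_nhds_unique h2 (tendsto_const_nhds.congr iter)
  have h4 := (hsm (-x)).hasSum
  rw [← h3] at h4
  simp only [ha, qc_zero] at h4
  simp at h4
  convert h4 using 2 with k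
  · rw [neg_pow]; ring

/-! ### Theta series, the ₁ψ₁ limit and the Jacobi triple product. -/

lemma hasSum_of_eq {ι : Type*} {f g : ι → ℂ} {a : ℂ} (h : HasSum f a) (hfg : ∀ i, f i = g i) :
    HasSum g a := by
  rwa [← funext hfg]

/-- The terms are those of Euler's second series multiplied by the bounded sequence (s²;s²)_k. -/
lemma summable_quadratic {s : ℂ} (hs0 : s ≠ 0) (hs : ‖s‖ < 1) {x : ℂ} (hx : x ≠ 0) :
    Summable fun k : ℕ => ‖s ^ ((k : ℤ) ^ 2 - k) * x ^ k‖ := by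
  have h := (summable_euler_two hs0 hs x)
  obtain h1 := (tendsto_qPoch (s ^ 2) (norm_pow_lt_one hs two_ne_zero))
  obtain ⟨M, hM⟩ := (Metric.isBounded_range_of_tendsto _ h1).exists_norm_le
  refine Summable.of_nonneg_of_le (fun _ => norm_nonneg _) (fun k => ?_) (h.mul_right M)
  have h2 : s ^ ((k : ℤ) ^ 2 - k) * x ^ k =
      (x ^ k * (s ^ ((k : ℤ) ^ 2 - k) * qc (s ^ 2) k)) * qPoch (s ^ 2) (s ^ 2) k := by
    have := qc_ne_zero (norm_pow_lt_one hs two_ne_zero) k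
    unfold qc at *
    have h3 : qPoch (s ^ 2) (s ^ 2) k ≠ 0 := fun h => this (by rw [h, inv_zero])
    field_simp
  rw [h2, norm_mul]
  gcongr
  exact hM _ ⟨k, rfl⟩

lemma summable_quadratic_mul {s : ℂ} (hs0 : s ≠ 0) (hs : ‖s‖ < 1) {x : ℂ} (hx : x ≠ 0)
    {a : ℕ → ℂ} {M : ℝ} (ha : ∀ k, ‖a k‖ ≤ M) :
    Summable fun k : ℕ => ‖s ^ ((k : ℤ) ^ 2 - k) * x ^ k * a k‖ := by
  refine Summable.of_nonneg_of_le (fun _ => norm_nonneg _) (fun k => ?_)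
    ((summable_quadratic hs0 hs hx).mul_right M)
  rw [norm_mul _ (a k)]
  gcongr
  exact ha k

lemma summable_theta {s : ℂ} (hs0 : s ≠ 0) (hs : ‖s‖ < 1) {z : ℂ} (hz : z ≠ 0) :
    Summable fun n : ℤ => ‖s ^ (n ^ 2 - n) * z ^ n‖ := by
  refine Summable.of_nat_of_neg ?_ ?_
  · simpa using summable_quadratic hs0 hs hz
  -- Reflecting n ↦ -n replaces z by s²/z.
  · have := summable_quadratic hs0 hs (x := s ^ 2 * z⁻¹) (by positivity)
    refine this.congr fun k => ?_
    congr 1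
    have : (-(k : ℤ)) ^ 2 - (-(k : ℤ)) = ((k : ℤ) ^ 2 - k) + ((2 * k : ℕ) : ℤ) := by
      push_cast; ring
    rw [this, zpow_add₀ hs0, zpow_natCast, mul_pow, zpow_neg, zpow_natCast, inv_pow, pow_mul]
    ring

/-- The theta series `∑ s^(n² - n) z^n`. -/
noncomputable def Theta (s z : ℂ) : ℂ := ∑' n : ℤ, s ^ (n ^ 2 - n) * z ^ n

lemma hasSum_theta {s : ℂ} (hs0 : s ≠ 0) (hs : ‖s‖ < 1) {z : ℂ} (hz : z ≠ 0) :
    HasSum (fun n : ℤ => s ^ (n ^ 2 - n) * z ^ n) (Theta s z) :=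
  (summable_theta hs0 hs hz).of_norm.hasSum

/-- Summation of a double series whose terms factor after the shear `(n, k) ↦ (n + k, k)`. -/
lemma hasSum_of_shear {f : ℤ → ℂ} {g : ℕ → ℂ} {F : ℤ → ℕ → ℂ} {E : ℤ → ℂ} {A B : ℂ}
    (hf : Summable fun n => ‖f n‖) (hg : Summable fun k => ‖g k‖)
    (hA : HasSum f A) (hB : HasSum g B)
    (hF : ∀ n k, F n k = f (n + k) * g k) (hE : ∀ n, HasSum (F n) (E n)) :
    HasSum E (A * B) := by
  have h1 : HasSum (fun p : ℤ × ℕ => f p.1 * g p.2) (A * B) :=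
    hA.mul hB (summable_mul_of_summable_norm hf hg)
  let e : ℤ × ℕ ≃ ℤ × ℕ :=
    { toFun := fun p => (p.1 + p.2, p.2)
      invFun := fun p => (p.1 - p.2, p.2)
      left_inv := fun p => by simp
      right_inv := fun p => by simp }
  have h2 : HasSum (fun p : ℤ × ℕ => F p.1 p.2) (A * B) := by
    rw [← e.hasSum_iff] at h1
    convert h1 using 2 with p
    exact hF p.1 p.2
  exact h2.prod_fiberwise hE

/-- A limiting case of Ramanujan's `₁ψ₁` summation. -/
theorem hasSum_one_psi_one {s : ℂ} (hs0 : s ≠ 0) (hs : ‖s‖ < 1) {b z : ℂ} (hz : z ≠ 0)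
    (hbz : ‖b‖ < ‖z‖) :
    HasSum (fun n : ℤ => s ^ (n ^ 2 - n) * z ^ n * qPochInf (b * (s ^ 2) ^ n) (s ^ 2))
      (Theta s z * (qPochInf (-(b / z)) (s ^ 2))⁻¹) := by
  have hq := norm_pow_lt_one hs two_ne_zero
  have hx : ‖-(b / z)‖ < 1 := by
    rw [norm_neg, norm_div]
    exact (div_lt_one (norm_pos_iff.mpr hz)).mpr hbz
  refine hasSum_of_shear (summable_theta hs0 hs hz) (summable_euler_one hq hx)
    (hasSum_theta hs0 hs hz) (euler_one hq hx)
    (F := fun n k => s ^ (n ^ 2 - n) * z ^ n *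
      ((-1) ^ k * s ^ ((k : ℤ) ^ 2 - k) * (b * (s ^ 2) ^ n) ^ k * qc (s ^ 2) k)) ?_ ?_
  · intro n k
    -- The cross term 2nk is exactly what (b q^n)^k contributes, so the double sum factors in the
    -- variables n + k and k.
    have h1 : (n + k) ^ 2 - (n + k) = (n ^ 2 - n) + ((k : ℤ) ^ 2 - k) + (2 * n * k) := by ring
    have h2 : ((s ^ 2) ^ n) ^ k = s ^ (2 * n * k) := by
      rw [← zpow_natCast, ← zpow_natCast, ← zpow_mul, ← zpow_mul]
      push_cast; ring_nf
    rw [h1, zpow_add₀ hs0, zpow_add₀ hs0, zpow_add₀ hz, zpow_natCast, mul_pow, h2,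
      neg_pow (b / z), div_pow]
    field_simp
  · intro n
    exact (euler_two hs0 hs _).mul_left _

lemma qPochInf_zero_of_pow {q : ℂ} (hq : ‖q‖ < 1) {x : ℂ} {n : ℕ} (h : x * q ^ n = 1) :
    qPochInf x q = 0 := by
  rw [← qPoch_mul_qPochInf x hq (n + 1), qPoch_succ, h]
  simp

/-- The factor of index n is 1 - q^0. This vanishing cuts bilateral series with b = q down to n ≥ 0.
-/
lemma qPochInf_mul_zpow_neg {q : ℂ} (hq0 : q ≠ 0) (hq : ‖q‖ < 1) (n : ℕ) :
    qPochInf (q * q ^ (-((n : ℤ) + 1))) q = 0 := by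
  refine qPochInf_zero_of_pow hq (n := n) ?_
  rw [← zpow_natCast, mul_assoc, ← zpow_add₀ hq0, ← zpow_one_add₀ hq0]
  simp

lemma qPochInf_mul_pow {q : ℂ} (hq : ‖q‖ < 1) (n : ℕ) :
    qPochInf (q * q ^ n) q = qPochInf q q * qc q n := by
  rw [← qPoch_mul_qPochInf q hq n, qc]
  have := qPoch_ne_zero (mul_pow_ne_one hq hq) n
  field_simp

/-- A bilateral series weighted by `(q^(n+1); q)` reduces to its nonnegative part. -/
lemma hasSum_nat_of_bilateral {q : ℂ} (hq0 : q ≠ 0) (hq : ‖q‖ < 1) {w : ℤ → ℂ} {A : ℂ}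
    (h : HasSum (fun n : ℤ => w n * qPochInf (q * q ^ n) q) A) :
    HasSum (fun n : ℕ => qPochInf q q * (w n * qc q n)) A := by
  have h1 : Function.Injective ((↑) : ℕ → ℤ) := Nat.cast_injective
  rw [← h1.hasSum_iff] at h
  · refine hasSum_of_eq h fun n => ?_
    simp only [Function.comp_apply, zpow_natCast]
    rw [qPochInf_mul_pow hq]
    ring
  · intro n hn
    obtain ⟨m, rfl⟩ : ∃ m : ℕ, n = -((m : ℤ) + 1) := by
      refine ⟨(-n - 1).toNat, ?_⟩
      have : n < 0 := by
        by_contra hh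
        exact hn ⟨n.toNat, by simp; omega⟩
      omega
    rw [qPochInf_mul_zpow_neg hq0 hq, mul_zero]

/-- Jacobi's triple product identity. -/
theorem jacobi_triple {s : ℂ} (hs0 : s ≠ 0) (hs : ‖s‖ < 1) {z : ℂ} (hz : ‖s ^ 2‖ < ‖z‖) :
    Theta s z = qPochInf (s ^ 2) (s ^ 2) * qPochInf (-z) (s ^ 2) *
      qPochInf (-(s ^ 2 / z)) (s ^ 2) := by
  have hq := norm_pow_lt_one hs two_ne_zero
  have hz0 : z ≠ 0 := norm_pos_iff.mp ((norm_nonneg _).trans_lt hz)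
  have h1 := hasSum_nat_of_bilateral (pow_ne_zero 2 hs0) hq (hasSum_one_psi_one hs0 hs hz0 hz)
  have h2 := (euler_two hs0 hs (-z)).mul_left (qPochInf (s ^ 2) (s ^ 2))
  have h3 := h1.unique (hasSum_of_eq h2 fun k => ?_)
  · have h4 : qPochInf (-(s ^ 2 / z)) (s ^ 2) ≠ 0 := by
      refine qPochInf_ne_zero_of_norm_lt hq ?_
      rw [norm_neg, norm_div]
      exact (div_lt_one (norm_pos_iff.mpr hz0)).mpr hz
    rw [← h3]
    field_simp
  · rw [neg_pow z, zpow_natCast]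
    have : (-1 : ℂ) ^ k * (-1) ^ k = 1 := by rw [← mul_pow]; simp
    linear_combination (s ^ ((k : ℤ) ^ 2 - k) * z ^ k * qc (s ^ 2) k * qPochInf (s ^ 2) (s ^ 2)) * this

/-! ### Splitting a bilateral series by parity. -/

/-- Euler's expansion gives the exponent n² + nk + k(k-1)/2, whose completed square involves n +
k/2. Hence k = 2j and k = 2j + 1 are treated separately, each by the shear n ↦ n + j; they produce
the theta series with exponents n² and n² + n. -/
lemma hasSum_two_psi_two {s : ℂ} (hs0 : s ≠ 0) (hs : ‖s‖ < 1) {b z : ℂ} (hb : b ≠ 0) (hz : z ≠ 0)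
    {A B : ℂ}
    (hA : HasSum (fun j : ℕ => (s ^ 2) ^ ((j : ℤ) ^ 2 - j) * (b ^ 2 / z) ^ j * qc (s ^ 2) (2 * j)) A)
    (hB : HasSum
      (fun j : ℕ => (s ^ 2) ^ ((j : ℤ) ^ 2) * (b ^ 2 / z) ^ j * qc (s ^ 2) (2 * j + 1)) B) :
    HasSum (fun n : ℤ => (s ^ 2) ^ (n ^ 2) * z ^ n * qPochInf (b * (s ^ 2) ^ n) (s ^ 2))
      (Theta (s ^ 2) (z * s ^ 2) * A - b * (Theta (s ^ 2) (z * (s ^ 2) ^ 2) * B)) := by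
  have hq := norm_pow_lt_one hs two_ne_zero
  set q := s ^ 2 with hqs
  have hq0 : q ≠ 0 := pow_ne_zero 2 hs0
  obtain ⟨M, -, hc⟩ := exists_norm_qc_le hq
  have hsA := summable_quadratic_mul hq0 hq (x := b ^ 2 / z) (by positivity)
    (a := fun j => qc q (2 * j)) (fun j => hc _)
  have hsB := summable_quadratic_mul hq0 hq (x := b ^ 2 / z * q) (by positivity)
    (a := fun j => qc q (2 * j + 1)) (fun j => hc _)
  have hqj : ∀ j : ℕ, q ^ ((j : ℤ) ^ 2) = q ^ ((j : ℤ) ^ 2 - j) * q ^ j := by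
    intro j
    rw [← zpow_natCast, ← zpow_add₀ hq0]; simp
  have hsB' : Summable fun j : ℕ => ‖q ^ ((j : ℤ) ^ 2) * (b ^ 2 / z) ^ j * qc q (2 * j + 1)‖ := by
    refine hsB.congr fun j => ?_
    rw [hqj, mul_pow]
    ring_nf
  set T : ℤ → ℕ → ℂ := fun n k =>
    (-1) ^ k * s ^ ((k : ℤ) ^ 2 - k) * (b * q ^ n) ^ k * qc q k with hT
  have hTs : ∀ n, HasSum (T n) (qPochInf (b * q ^ n) q) := fun n => euler_two hs0 hs _
  have hTe : ∀ n, Summable fun j => T n (2 * j) := fun n =>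
    (hTs n).summable.comp_injective (fun a b h => by simpa using h)
  have hTo : ∀ n, Summable fun j => T n (2 * j + 1) := fun n =>
    (hTs n).summable.comp_injective (fun a b h => by simpa using h)
  have hw : ∀ n : ℤ, q ^ n = s ^ (2 * n) := fun n => by
    rw [hqs, ← zpow_natCast, ← zpow_mul]; rfl
  have hev : HasSum (fun n : ℤ => q ^ (n ^ 2) * z ^ n * ∑' j, T n (2 * j))
      (Theta q (z * q) * A) := by
    refine hasSum_of_shear (summable_theta hq0 hq (mul_ne_zero hz hq0)) hsA
      (hasSum_theta hq0 hq (mul_ne_zero hz hq0)) hA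
      (F := fun n j => q ^ (n ^ 2) * z ^ n * T n (2 * j)) ?_ (fun n => (hTe n).hasSum.mul_left _)
    intro n j
    have e1 : (q ^ n) ^ (2 * j) = q ^ (2 * n * j) := by
      rw [← zpow_natCast, ← zpow_mul]; push_cast; ring_nf
    have e2 : s ^ (((2 * j : ℕ) : ℤ) ^ 2 - (2 * j : ℕ)) = q ^ (2 * (j : ℤ) ^ 2 - j) := by
      rw [hw]; push_cast; ring_nf
    simp only [hT]
    rw [mul_pow, e1, e2, mul_zpow, zpow_add₀ hz, zpow_natCast z j, div_pow, pow_mul b]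
    -- Even k: n² + 2nj + 2j² - j = (n + j)² + (j² - j).
    have e3 : q ^ ((n + j) ^ 2 - (n + (j : ℤ))) * q ^ (n + (j : ℤ)) * q ^ ((j : ℤ) ^ 2 - j) =
        q ^ (n ^ 2) * q ^ (2 * n * j) * q ^ (2 * (j : ℤ) ^ 2 - j) := by
      simp only [← zpow_add₀ hq0]; ring_nf
    have : (-1 : ℂ) ^ (2 * j) = 1 := by simp
    rw [this]
    field_simp
    linear_combination (-(qc q (2 * j))) * e3
  have hod : HasSum (fun n : ℤ => q ^ (n ^ 2) * z ^ n * ∑' j, T n (2 * j + 1))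
      (Theta q (z * q ^ 2) * (-b * B)) := by
    refine hasSum_of_shear (summable_theta hq0 hq (mul_ne_zero hz (pow_ne_zero 2 hq0)))
      (g := fun j => -b * (q ^ ((j : ℤ) ^ 2) * (b ^ 2 / z) ^ j * qc q (2 * j + 1))) ?_
      (hasSum_theta hq0 hq (mul_ne_zero hz (pow_ne_zero 2 hq0))) (hB.mul_left _)
      (F := fun n j => q ^ (n ^ 2) * z ^ n * T n (2 * j + 1)) ?_
      (fun n => (hTo n).hasSum.mul_left _)
    · simpa only [norm_mul] using hsB'.mul_left ‖-b‖
    intro n j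
    have e1 : (q ^ n) ^ (2 * j + 1) = q ^ (2 * n * j + n) := by
      rw [← zpow_natCast, ← zpow_mul]; push_cast; ring_nf
    have e2 : s ^ (((2 * j + 1 : ℕ) : ℤ) ^ 2 - (2 * j + 1 : ℕ)) = q ^ (2 * (j : ℤ) ^ 2 + j) := by
      rw [hw]; push_cast; ring_nf
    simp only [hT]
    have e4 : (q ^ 2) ^ (n + (j : ℤ)) = q ^ (2 * n + 2 * j) := by
      rw [← zpow_natCast, ← zpow_mul]; push_cast; ring_nf
    rw [mul_pow, e1, e2, mul_zpow, e4, zpow_add₀ hz, zpow_natCast z j, div_pow, pow_succ b, pow_mul b]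
    -- Odd k: n² + n(2j + 1) + 2j² + j = (n + j)² + (n + j) + j².
    have e3 : q ^ ((n + j) ^ 2 - (n + (j : ℤ))) * q ^ (2 * n + 2 * (j : ℤ)) * q ^ ((j : ℤ) ^ 2) =
        q ^ (n ^ 2) * q ^ (2 * n * j + n) * q ^ (2 * (j : ℤ) ^ 2 + j) := by
      simp only [← zpow_add₀ hq0]; ring_nf
    have : (-1 : ℂ) ^ (2 * j + 1) = -1 := by simp [pow_succ]
    rw [this]
    field_simp
    linear_combination (qc q (2 * j + 1)) * e3
  convert hev.add hod using 1
  · funext n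
    rw [← mul_add, ← ((hTe n).hasSum.even_add_odd (hTo n).hasSum).unique (hTs n)]
  · ring

/-! ### Finite sums of q-binomial type. -/

open Finset in
lemma sum_antidiagonal_shift_left {q : ℂ} (hq : ‖q‖ < 1) (w : ℕ → ℕ → ℂ) (N : ℕ) :
    ∑ p ∈ antidiagonal (N + 1), w p.1 p.2 * (1 - q ^ p.1) * (qc q p.1 * qc q p.2) =
      ∑ p ∈ antidiagonal N, w (p.1 + 1) p.2 * (qc q p.1 * qc q p.2) := by
  rw [Nat.sum_antidiagonal_succ]
  simp only [pow_zero, sub_self, mul_zero, zero_mul, zero_add]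
  refine sum_congr rfl fun p _ => ?_
  rw [← qc_succ hq p.1]
  ring

open Finset in
lemma sum_antidiagonal_shift_right {q : ℂ} (hq : ‖q‖ < 1) (w : ℕ → ℕ → ℂ) (N : ℕ) :
    ∑ p ∈ antidiagonal (N + 1), w p.1 p.2 * (1 - q ^ p.2) * (qc q p.1 * qc q p.2) =
      ∑ p ∈ antidiagonal N, w p.1 (p.2 + 1) * (qc q p.1 * qc q p.2) := by
  rw [Nat.sum_antidiagonal_succ']
  simp only [pow_zero, sub_self, mul_zero, zero_mul, zero_add]
  refine sum_congr rfl fun p _ => ?_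
  rw [← qc_succ hq p.2]
  ring

open Finset in
/-- Recurrence for Gauss's alternating sum of `q`-binomial coefficients. -/
lemma gauss_sum_rec {q : ℂ} (hq : ‖q‖ < 1) (N : ℕ) :
    (1 - q ^ (N + 2)) * ∑ p ∈ antidiagonal (N + 2), (-1) ^ p.2 * (qc q p.1 * qc q p.2) =
      ∑ p ∈ antidiagonal N, (-1) ^ p.2 * (qc q p.1 * qc q p.2) := by
  -- Writing 1 - q^(i+j) = q^j (1 - q^i) + (1 - q^j) lowers the total to N + 1. The two sums then
  -- combine to the weight (-1)^(j+1) (1 - q^j), which lowers it once more.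
  have h1 := sum_antidiagonal_shift_left hq (fun _ j => (-1) ^ j * q ^ j) (N + 1)
  have h2 := sum_antidiagonal_shift_right hq (fun _ j => (-1) ^ j) (N + 1)
  have h3 := sum_antidiagonal_shift_right hq (fun _ j => (-1) ^ (j + 1)) N
  have h4 : ∑ p ∈ antidiagonal (N + 1), (-1 : ℂ) ^ (p.2 + 1) * (1 - q ^ p.2) *
        (qc q p.1 * qc q p.2) =
      ∑ p ∈ antidiagonal (N + 1), (-1) ^ p.2 * q ^ p.2 * (qc q p.1 * qc q p.2) +
        ∑ p ∈ antidiagonal (N + 1), (-1) ^ (p.2 + 1) * (qc q p.1 * qc q p.2) := by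
    rw [← sum_add_distrib]
    refine sum_congr rfl fun p _ => ?_
    ring
  have h5 : ∑ p ∈ antidiagonal N, (-1) ^ p.2 * (qc q p.1 * qc q p.2) =
      ∑ p ∈ antidiagonal N, (-1) ^ (p.2 + 1 + 1) * (qc q p.1 * qc q p.2) :=
    sum_congr rfl fun p _ => by ring
  rw [h5, ← h3, h4, ← h1, ← h2, ← sum_add_distrib, mul_sum]
  refine sum_congr rfl fun p hp => ?_
  rw [← mem_antidiagonal.mp hp, pow_add]
  ring

open Finset in
lemma gauss_sum_odd {q : ℂ} (hq : ‖q‖ < 1) (m : ℕ) :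
    ∑ p ∈ antidiagonal (2 * m + 1), (-1) ^ p.2 * (qc q p.1 * qc q p.2) = 0 := by
  induction m with
  | zero =>
    have : antidiagonal (2 * 0 + 1) = {(0, 1), (1, 0)} := rfl
    rw [this]
    simp
    ring
  | succ m ih =>
    have := gauss_sum_rec hq (2 * m + 1)
    rw [ih] at this
    exact (mul_eq_zero.mp this).resolve_left (one_sub_pow_ne_zero hq _)

open Finset in
lemma gauss_sum_even {q : ℂ} (hq : ‖q‖ < 1) (m : ℕ) :
    ∑ p ∈ antidiagonal (2 * m), (-1) ^ p.2 * (qc q p.1 * qc q p.2) = qc (q ^ 2) m := by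
  induction m with
  | zero => simp [qc_zero]
  | succ m ih =>
    have h1 := gauss_sum_rec hq (2 * m)
    rw [ih, ← qc_succ (norm_pow_lt_one hq two_ne_zero)] at h1
    have h2 : (q ^ 2) ^ (m + 1) = q ^ (2 * m + 2) := by ring
    rw [h2] at h1
    exact mul_left_cancel₀ (one_sub_pow_ne_zero hq _) h1

open Finset in
/-- The finite `q`-binomial theorem. -/
lemma q_binomial {s : ℂ} (hs0 : s ≠ 0) (hs : ‖s‖ < 1) (x : ℂ) (N : ℕ) :
    ∑ p ∈ antidiagonal N, ((-1) ^ p.2 * s ^ ((p.2 : ℤ) ^ 2 - p.2) * x ^ p.2) *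
      (qc (s ^ 2) p.1 * qc (s ^ 2) p.2) = qPoch x (s ^ 2) N * qc (s ^ 2) N := by
  have hq := norm_pow_lt_one hs two_ne_zero
  induction N with
  | zero => simp [qc_zero, qPoch_zero]
  | succ N ih =>
    refine mul_left_cancel₀ (one_sub_pow_ne_zero hq N) ?_
    -- Here 1 - q^(i+j) = (1 - q^i) + q^i (1 - q^j); each summand lowers one index, and both reduce
    -- to the sum at N.
    have h1 := sum_antidiagonal_shift_left hq
      (fun _ j => (-1) ^ j * s ^ ((j : ℤ) ^ 2 - j) * x ^ j) N
    have h2 := sum_antidiagonal_shift_right hq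
      (fun i j => (-1) ^ j * s ^ ((j : ℤ) ^ 2 - j) * x ^ j * (s ^ 2) ^ i) N
    have h3 : ∑ p ∈ antidiagonal N, (-1) ^ (p.2 + 1) *
          s ^ (((p.2 + 1 : ℕ) : ℤ) ^ 2 - (p.2 + 1 : ℕ)) * x ^ (p.2 + 1) * (s ^ 2) ^ p.1 *
          (qc (s ^ 2) p.1 * qc (s ^ 2) p.2) =
        -(x * (s ^ 2) ^ N) * ∑ p ∈ antidiagonal N, ((-1) ^ p.2 * s ^ ((p.2 : ℤ) ^ 2 - p.2) *
          x ^ p.2) * (qc (s ^ 2) p.1 * qc (s ^ 2) p.2) := by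
      rw [mul_sum]
      refine sum_congr rfl fun p hp => ?_
      have : ((p.2 + 1 : ℕ) : ℤ) ^ 2 - (p.2 + 1 : ℕ) =
          ((p.2 : ℤ) ^ 2 - p.2) + ((2 * p.2 : ℕ) : ℤ) := by push_cast; ring
      rw [this, zpow_add₀ hs0, zpow_natCast, ← mem_antidiagonal.mp hp]
      ring
    calc _ = ∑ p ∈ antidiagonal (N + 1), (-1) ^ p.2 * s ^ ((p.2 : ℤ) ^ 2 - p.2) * x ^ p.2 *
              (1 - (s ^ 2) ^ p.1) * (qc (s ^ 2) p.1 * qc (s ^ 2) p.2) +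
            ∑ p ∈ antidiagonal (N + 1), (-1) ^ p.2 * s ^ ((p.2 : ℤ) ^ 2 - p.2) * x ^ p.2 *
              (s ^ 2) ^ p.1 * (1 - (s ^ 2) ^ p.2) * (qc (s ^ 2) p.1 * qc (s ^ 2) p.2) := by
          rw [← sum_add_distrib, mul_sum]
          refine sum_congr rfl fun p hp => ?_
          rw [← mem_antidiagonal.mp hp, pow_add (s ^ 2)]
          ring
      _ = (1 - x * (s ^ 2) ^ N) * (qPoch x (s ^ 2) N * qc (s ^ 2) N) := by
          rw [h1, h2, h3, ih]
          ring
      _ = _ := by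
          rw [qPoch_succ, ← qc_succ hq N]
          ring

/-! ### Rogers' sums with denominators (q;q)_{2n} and (q;q)_{2n+1}. -/

/-- Rearranging a double series along antidiagonals. -/
lemma hasSum_of_antidiagonal {F : ℕ → ℕ → ℂ} {E D : ℕ → ℂ} {A : ℂ}
    (hF : Summable fun p : ℕ × ℕ => F p.1 p.2) (hE : ∀ n, HasSum (F n) (E n))
    (hD : ∀ N, ∑ p ∈ Finset.HasAntidiagonal.antidiagonal N, F p.1 p.2 = D N) (hA : HasSum D A) :
    HasSum E A := by
  have h1 := hF.hasSum.prod_fiberwise hE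
  have h2 := Finset.HasAntidiagonal.sigmaAntidiagonalEquivProd.hasSum_iff.mpr hF.hasSum
  have h3 := h2.sigma (g := D) fun N => by
    rw [← hD N, ← Finset.sum_coe_sort]
    exact hasSum_fintype _
  rw [hA.unique h3]
  exact h1

lemma summable_of_norm_le_pow {f : ℕ × ℕ → ℂ} {ρ M : ℝ} (h0 : 0 ≤ ρ) (h1 : ρ < 1)
    (h : ∀ p, ‖f p‖ ≤ ρ ^ (p.1 + p.2) * M) : Summable f := by
  have hg := summable_geometric_of_lt_one h0 h1
  have h2 : Summable fun p : ℕ × ℕ => ρ ^ p.1 * ρ ^ p.2 :=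
    hg.mul_of_nonneg hg (fun _ => by positivity) (fun _ => by positivity)
  refine Summable.of_norm_bounded (h2.mul_right M) fun p => ?_
  rw [← pow_add]
  exact h p

lemma norm_zpow_sq_sub_le_one {s : ℂ} (hs : ‖s‖ < 1) (j : ℕ) : ‖s ^ ((j : ℤ) ^ 2 - j)‖ ≤ 1 := by
  have : (j : ℤ) ^ 2 - j = ((j ^ 2 - j : ℕ) : ℤ) := by
    rw [Nat.cast_sub (Nat.le_self_pow two_ne_zero j)]; push_cast; ring
  rw [this, zpow_natCast, norm_pow]
  exact pow_le_one₀ (norm_nonneg _) hs.le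

/-- Expanding the product in j, the exponent i² + (j² - j) + (2i + 1)j is the square (i + j)². The
sum over i + j = N is therefore Gauss's alternating sum, which vanishes for odd N and is
1/(q^4;q^4)_m for N = 2m. -/
lemma hasSum_even_of_antidiagonal {q : ℂ} (hq0 : q ≠ 0) (hq : ‖q‖ < 1) {y : ℂ} (hy : ‖y‖ ≤ 1)
    {A : ℂ} (hA : HasSum (fun m : ℕ => q ^ (4 * m ^ 2) * y ^ (2 * m) * qc (q ^ 4) m) A) :
    HasSum (fun n : ℕ => q ^ (n ^ 2) * y ^ n * qc (q ^ 2) n * qPochInf (y * q ^ (2 * n + 1)) (q ^ 2))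
      A := by
  have hq2 := norm_pow_lt_one hq two_ne_zero
  obtain ⟨M, hM, hc⟩ := exists_norm_qc_le hq2
  have hF : ∀ i j : ℕ, q ^ (i ^ 2) * y ^ i * qc (q ^ 2) i *
      ((-1) ^ j * q ^ ((j : ℤ) ^ 2 - j) * (y * q ^ (2 * i + 1)) ^ j * qc (q ^ 2) j) =
      q ^ ((i + j) ^ 2) * y ^ (i + j) * ((-1) ^ j * (qc (q ^ 2) i * qc (q ^ 2) j)) := by
    intro i j
    have e : q ^ ((i + j) ^ 2) = q ^ (i ^ 2) * q ^ ((j : ℤ) ^ 2 - j) * (q ^ (2 * i + 1)) ^ j := by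
      rw [← zpow_natCast, ← zpow_natCast, ← zpow_natCast, ← zpow_natCast, ← zpow_mul,
        ← zpow_add₀ hq0, ← zpow_add₀ hq0]
      congr 1; push_cast; ring
    rw [e, mul_pow]
    ring
  have hE : ∀ i : ℕ, HasSum (fun j : ℕ => q ^ (i ^ 2) * y ^ i * qc (q ^ 2) i *
      ((-1) ^ j * q ^ ((j : ℤ) ^ 2 - j) * (y * q ^ (2 * i + 1)) ^ j * qc (q ^ 2) j))
      (q ^ (i ^ 2) * y ^ i * qc (q ^ 2) i * qPochInf (y * q ^ (2 * i + 1)) (q ^ 2)) :=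
    fun i => (euler_two hq0 hq (y * q ^ (2 * i + 1))).mul_left (q ^ (i ^ 2) * y ^ i * qc (q ^ 2) i)
  refine hasSum_of_antidiagonal (D := fun N => q ^ (N ^ 2) * y ^ N *
    ∑ p ∈ Finset.HasAntidiagonal.antidiagonal N, (-1) ^ p.2 * (qc (q ^ 2) p.1 * qc (q ^ 2) p.2))
    ?_ hE ?_ ?_
  · refine summable_of_norm_le_pow (norm_nonneg q) hq (M := M * M) fun ⟨i, j⟩ => ?_
    rw [hF]
    simp only [norm_mul, norm_pow, norm_neg, norm_one, one_pow, one_mul]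
    have h1 : ‖q‖ ^ ((i + j) ^ 2) ≤ ‖q‖ ^ (i + j) :=
      pow_le_pow_of_le_one (norm_nonneg _) hq.le (Nat.le_self_pow two_ne_zero _)
    have h2 : ‖y‖ ^ (i + j) ≤ 1 := pow_le_one₀ (norm_nonneg _) hy
    calc _ ≤ ‖q‖ ^ (i + j) * 1 * (M * M) := by
          gcongr
          · exact hc i
          · exact hc j
      _ = _ := by ring
  · intro N
    rw [Finset.mul_sum]
    refine Finset.sum_congr rfl fun p hp => ?_
    rw [hF, Finset.HasAntidiagonal.mem_antidiagonal.mp hp]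
  · rw [← add_zero A]
    refine HasSum.even_add_odd ?_ ?_
    · refine hasSum_of_eq hA fun m => ?_
      rw [gauss_sum_even hq2]
      ring_nf
    · refine hasSum_of_eq hasSum_zero fun m => ?_
      rw [gauss_sum_odd hq2, mul_zero]

lemma qPoch_two_mul (q : ℂ) (n : ℕ) :
    qPoch q q (2 * n) = qPoch q (q ^ 2) n * qPoch (q ^ 2) (q ^ 2) n := by
  induction n with
  | zero => simp [qPoch]
  | succ n ih =>
    rw [show 2 * (n + 1) = 2 * n + 1 + 1 by ring, qPoch_succ, qPoch_succ, qPoch_succ, qPoch_succ, ih]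
    ring

lemma qPoch_two_mul_add_one (q : ℂ) (n : ℕ) :
    qPoch q q (2 * n + 1) = qPoch q (q ^ 2) (n + 1) * qPoch (q ^ 2) (q ^ 2) n := by
  rw [qPoch_succ, qPoch_succ, qPoch_two_mul]
  ring

/-- The Rogers–Ramanujan series `∑ q^(n² + e n) / (q; q)_n`. -/
noncomputable def RR (e : ℕ) (q : ℂ) : ℂ := ∑' n : ℕ, q ^ (n ^ 2 + e * n) * qc q n

lemma hasSum_RR (e : ℕ) {q : ℂ} (hq : ‖q‖ < 1) :
    HasSum (fun n : ℕ => q ^ (n ^ 2 + e * n) * qc q n) (RR e q) := by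
  obtain ⟨M, hM, hc⟩ := exists_norm_qc_le hq
  refine Summable.hasSum (Summable.of_norm_bounded
    ((summable_geometric_of_lt_one (norm_nonneg q) hq).mul_right M) fun n => ?_)
  rw [norm_mul, norm_pow]
  refine mul_le_mul ?_ (hc n) (norm_nonneg _) (by positivity)
  exact pow_le_pow_of_le_one (norm_nonneg _) hq.le
    ((Nat.le_self_pow two_ne_zero n).trans (Nat.le_add_right _ _))

/-- The case y = 1: the tail (q^(2n+1);q²) is (q;q²)/(q;q²)_n, and (q;q²)_n (q²;q²)_n = (q;q)_{2n}.
The odd companion takes y = q². -/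
lemma hasSum_rogers_even {q : ℂ} (hq0 : q ≠ 0) (hq : ‖q‖ < 1) :
    HasSum (fun n : ℕ => q ^ (n ^ 2) * qc q (2 * n)) (RR 0 (q ^ 4) / qPochInf q (q ^ 2)) := by
  have hq2 := norm_pow_lt_one hq two_ne_zero
  have h := hasSum_even_of_antidiagonal hq0 hq (y := 1) (by simp) (A := RR 0 (q ^ 4))
    (hasSum_of_eq (hasSum_RR 0 (norm_pow_lt_one hq four_ne_zero)) fun n => by ring)
  refine hasSum_of_eq (h.div_const (qPochInf q (q ^ 2))) fun n => ?_
  have e : qPochInf (1 * q ^ (2 * n + 1)) (q ^ 2) * qPoch q (q ^ 2) n = qPochInf q (q ^ 2) := by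
    rw [← qPoch_mul_qPochInf q hq2 n, mul_comm]; ring_nf
  have h1 := qPochInf_ne_zero_of_norm_lt hq2 hq
  have h2 := qPoch_ne_zero (mul_pow_ne_one hq2 hq) n
  have h3 := qPoch_ne_zero (mul_pow_ne_one hq2 hq2) n
  rw [← e] at h1 ⊢
  unfold qc
  rw [qPoch_two_mul]
  have h4 := left_ne_zero_of_mul h1
  simp only [one_mul, one_pow] at *
  field_simp

lemma hasSum_rogers_odd {q : ℂ} (hq0 : q ≠ 0) (hq : ‖q‖ < 1) :
    HasSum (fun n : ℕ => q ^ (n ^ 2 + 2 * n) * qc q (2 * n + 1))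
      (RR 1 (q ^ 4) / qPochInf q (q ^ 2)) := by
  have hq2 := norm_pow_lt_one hq two_ne_zero
  have h := hasSum_even_of_antidiagonal hq0 hq (y := q ^ 2) hq2.le (A := RR 1 (q ^ 4))
    (hasSum_of_eq (hasSum_RR 1 (norm_pow_lt_one hq four_ne_zero)) fun n => by ring)
  refine hasSum_of_eq (h.div_const (qPochInf q (q ^ 2))) fun n => ?_
  have e : qPochInf (q ^ 2 * q ^ (2 * n + 1)) (q ^ 2) * qPoch q (q ^ 2) (n + 1) =
      qPochInf q (q ^ 2) := by
    rw [← qPoch_mul_qPochInf q hq2 (n + 1), mul_comm]; ring_nf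
  have h1 := qPochInf_ne_zero_of_norm_lt hq2 hq
  have h2 := qPoch_ne_zero (mul_pow_ne_one hq2 hq) (n + 1)
  have h3 := qPoch_ne_zero (mul_pow_ne_one hq2 hq2) n
  rw [← e] at h1 ⊢
  unfold qc
  rw [qPoch_two_mul_add_one]
  have h4 := left_ne_zero_of_mul h1
  field_simp
  ring_nf

/-! ### Rogers–Ramanujan series as theta series. -/

/-- A limiting case of the `q`-Gauss sum, due to Cauchy. -/
theorem hasSum_cauchy {s : ℂ} (hs0 : s ≠ 0) (hs : ‖s‖ < 1) (a : ℕ) :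
    HasSum (fun m : ℕ => (s ^ 2) ^ (m ^ 2 + a * m) * (qc (s ^ 2) m * qc (s ^ 2) (m + a)))
      (qPochInf (s ^ 2) (s ^ 2))⁻¹ := by
  have hq := norm_pow_lt_one hs two_ne_zero
  set q := s ^ 2 with hqs
  have hq0 : q ≠ 0 := pow_ne_zero 2 hs0
  obtain ⟨M, hM, hc⟩ := exists_norm_qc_le hq
  have hP := qPochInf_ne_zero_of_norm_lt hq hq
  have key : HasSum (fun m : ℕ => q ^ (m ^ 2 + a * m) * qc q m * qPochInf (q * q ^ (m + a)) q) 1 := by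
    have hE : ∀ i : ℕ, HasSum (fun j : ℕ => q ^ (i ^ 2 + a * i) * qc q i *
        ((-1) ^ j * s ^ ((j : ℤ) ^ 2 - j) * (q * q ^ (i + a)) ^ j * qc q j))
        (q ^ (i ^ 2 + a * i) * qc q i * qPochInf (q * q ^ (i + a)) q) :=
      fun i => (euler_two hs0 hs (q * q ^ (i + a))).mul_left (q ^ (i ^ 2 + a * i) * qc q i)
    refine hasSum_of_antidiagonal (D := fun N => if N = 0 then 1 else 0) ?_ hE ?_ (hasSum_ite_eq 0 1)
    · refine summable_of_norm_le_pow (norm_nonneg q) hq (M := M * M) fun ⟨i, j⟩ => ?_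
      have h1 : ‖q ^ (i ^ 2 + a * i)‖ ≤ ‖q‖ ^ i := by
        rw [norm_pow]
        exact pow_le_pow_of_le_one (norm_nonneg _) hq.le
          ((Nat.le_self_pow two_ne_zero i).trans (Nat.le_add_right _ _))
      have h2 : ‖(q * q ^ (i + a)) ^ j‖ ≤ ‖q‖ ^ j := by
        rw [norm_pow, norm_mul]
        gcongr
        refine mul_le_of_le_one_right (norm_nonneg _) ?_
        rw [norm_pow]
        exact pow_le_one₀ (norm_nonneg _) hq.le
      have h3 := norm_zpow_sq_sub_le_one hs j
      simp only [norm_mul _ (qc q _), norm_mul _ (_ * qc q j)]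
      rw [norm_mul _ ((q * q ^ (i + a)) ^ j), norm_mul ((-1) ^ j), norm_pow (-1), norm_neg, norm_one,
        one_pow, one_mul]
      calc _ ≤ ‖q‖ ^ i * M * (1 * ‖q‖ ^ j * M) := by
            gcongr
            · exact hc i
            · exact hc j
        _ = _ := by ring
    · intro N
      have h1 : ∀ p ∈ Finset.HasAntidiagonal.antidiagonal N, q ^ (p.1 ^ 2 + a * p.1) * qc q p.1 *
          ((-1) ^ p.2 * s ^ ((p.2 : ℤ) ^ 2 - p.2) * (q * q ^ (p.1 + a)) ^ p.2 * qc q p.2) =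
          q ^ (N ^ 2 + a * N) * (((-1) ^ p.2 * s ^ ((p.2 : ℤ) ^ 2 - p.2) * (q ^ (1 - (N : ℤ))) ^ p.2) *
            (qc q p.1 * qc q p.2)) := by
        intro p hp
        have e : q ^ (p.1 ^ 2 + a * p.1) * (q * q ^ (p.1 + a)) ^ p.2 =
            q ^ (N ^ 2 + a * N) * (q ^ (1 - (N : ℤ))) ^ p.2 := by
          rw [← pow_succ', ← Finset.HasAntidiagonal.mem_antidiagonal.mp hp]
          simp only [← zpow_natCast, ← zpow_mul, ← zpow_add₀ hq0]
          congr 1; push_cast; ring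
        linear_combination ((-1) ^ p.2 * s ^ ((p.2 : ℤ) ^ 2 - p.2) * qc q p.1 * qc q p.2) * e
      -- Each antidiagonal sum is a multiple of (q^(1-N);q)_N, whose last factor is 0 as soon as N ≥
      -- 1.
      rw [Finset.sum_congr rfl h1, ← Finset.mul_sum, q_binomial hs0 hs]
      rcases N with _ | N
      · simp [qPoch_zero, qc_zero]
      · rw [qPoch_succ, ← hqs, ← zpow_natCast q N, ← zpow_add₀ hq0]
        simp
  have h := key.div_const (qPochInf q q)
  rw [one_div] at h
  refine hasSum_of_eq h fun m => ?_
  rw [qPochInf_mul_pow hq]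
  field_simp

/-- The coefficient `1 / (q; q)_n` for integral `n`, zero for `n < 0`. -/
noncomputable def qcz (q : ℂ) (n : ℤ) : ℂ := if 0 ≤ n then qc q n.toNat else 0

lemma qcz_natCast (q : ℂ) (n : ℕ) : qcz q n = qc q n := by simp [qcz]

lemma qcz_of_neg (q : ℂ) {n : ℤ} (hn : n < 0) : qcz q n = 0 := by
  simp [qcz, hn]

lemma qcz_sub_one {q : ℂ} (hq : ‖q‖ < 1) (n : ℤ) : (1 - q ^ n) * qcz q n = qcz q (n - 1) := by
  rcases lt_trichotomy n 0 with h | rfl | h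
  · rw [qcz_of_neg q h, qcz_of_neg q (by omega), mul_zero]
  · rw [qcz_of_neg q (by omega : (0 : ℤ) - 1 < 0)]; simp
  · obtain ⟨m, rfl⟩ : ∃ m : ℕ, n = ((m + 1 : ℕ) : ℤ) := ⟨(n - 1).toNat, by omega⟩
    have : ((m + 1 : ℕ) : ℤ) - 1 = (m : ℤ) := by push_cast; ring
    rw [this, qcz_natCast, qcz_natCast, zpow_natCast, qc_succ hq]

lemma summable_qcz_mul (q : ℂ) (N M : ℤ) (w : ℤ → ℂ) :
    Summable fun r : ℤ => w r * (qcz q (N - r) * qcz q (M + r)) := by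
  refine summable_of_ne_finset_zero (s := Finset.Icc (-M) N) fun r hr => ?_
  rw [Finset.mem_Icc, not_and_or] at hr
  rcases hr with h | h
  · rw [qcz_of_neg q (by omega : M + r < 0)]; ring
  · rw [qcz_of_neg q (by omega : N - r < 0)]; ring

/-- The finite form of the pentagonal number series attached to `1 / (q; q)_N`. -/
noncomputable def pentU (s : ℂ) (N : ℤ) : ℂ :=
  ∑' r : ℤ, ((-1) ^ r * s ^ (3 * r ^ 2 - r)) * (qcz (s ^ 2) (N - r) * qcz (s ^ 2) (N + r))

/-- The companion of `pentU` attached to odd central index. -/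
noncomputable def pentV (s : ℂ) (N : ℤ) : ℂ :=
  ∑' r : ℤ, ((-1) ^ r * s ^ (3 * r ^ 2 + r)) * (qcz (s ^ 2) (N - r) * qcz (s ^ 2) (N + 1 + r))

lemma neg_one_zpow_neg (r : ℤ) : (-1 : ℂ) ^ (-r) = (-1) ^ r := by
  rw [zpow_neg, ← inv_zpow]; norm_num

/-- Inserting 1/(q;q)_{N+r} = (1 - q^(N+1+r))/(q;q)_{N+1+r} into `pentU` leaves `pentV` minus a sum
X. The reflection r ↦ -1 - r fixes the terms of X up to sign, so X = -X. -/
lemma pentV_eq_pentU {s : ℂ} (hs0 : s ≠ 0) (hs : ‖s‖ < 1) (N : ℤ) : pentV s N = pentU s N := by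
  have hq := norm_pow_lt_one hs two_ne_zero
  have hU : pentU s N = ∑' r : ℤ, ((-1) ^ r * s ^ (3 * r ^ 2 + r)) *
      (qcz (s ^ 2) (N - r) * qcz (s ^ 2) (N + r)) := by
    rw [pentU, ← (Equiv.neg ℤ).tsum_eq]
    refine tsum_congr fun r => ?_
    simp only [Equiv.neg_apply, neg_one_zpow_neg]
    rw [show 3 * (-r) ^ 2 - -r = 3 * r ^ 2 + r by ring, show N - -r = N + r by ring,
      show N + -r = N - r by ring]
    ring
  set X : ℂ := ∑' r : ℤ, ((-1) ^ r * (s ^ (3 * r ^ 2 + r) * (s ^ 2) ^ (N + 1 + r))) *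
      (qcz (s ^ 2) (N - r) * qcz (s ^ 2) (N + 1 + r)) with hX
  have h1 : pentU s N = pentV s N - X := by
    rw [hU, pentV, hX, ← (summable_qcz_mul _ _ _ _).tsum_sub (summable_qcz_mul _ _ _ _)]
    refine tsum_congr fun r => ?_
    rw [show N + r = N + 1 + r - 1 by ring, ← qcz_sub_one hq (N + 1 + r)]
    ring
  have h2 : X = -X := by
    have e : X = ∑' r : ℤ, -(((-1) ^ r * (s ^ (3 * r ^ 2 + r) * (s ^ 2) ^ (N + 1 + r))) *
        (qcz (s ^ 2) (N - r) * qcz (s ^ 2) (N + 1 + r))) := by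
      rw [hX, ← (Equiv.subLeft (-1 : ℤ)).tsum_eq]
      refine tsum_congr fun r => ?_
      simp only [Equiv.subLeft_apply]
      have e1 : (-1 : ℂ) ^ (-1 - r) = -(-1) ^ r := by
        rw [sub_eq_add_neg, zpow_add₀ (by norm_num), neg_one_zpow_neg r]
        simp
      have e2 : ∀ r : ℤ, s ^ (3 * r ^ 2 + r) * (s ^ 2) ^ (N + 1 + r) =
          s ^ (3 * r ^ 2 + 3 * r + 2 * N + 2) := by
        intro r
        rw [← zpow_natCast, ← zpow_mul, ← zpow_add₀ hs0]; push_cast; ring_nf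
      rw [e1, e2, e2, show 3 * (-1 - r) ^ 2 + 3 * (-1 - r) + 2 * N + 2 =
        3 * r ^ 2 + 3 * r + 2 * N + 2 by ring, show N - (-1 - r) = N + 1 + r by ring,
        show N + 1 + (-1 - r) = N - r by ring]
      ring
    rw [tsum_neg] at e
    exact e
  have h3 : X = 0 := by linear_combination h2 / 2
  rw [h1, h3, sub_zero]

/-- Splits 1 - q^(2N) = (1 - q^(N+r)) + q^(N+r) (1 - q^(N-r)). Each part lowers one denominator; the
first yields `pentV` at N - 1 after r ↦ -r, the second q^N times it. -/
lemma pentU_rec {s : ℂ} (hs0 : s ≠ 0) (hs : ‖s‖ < 1) (N : ℤ) :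
    (1 - (s ^ 2) ^ (2 * N)) * pentU s N = (1 + (s ^ 2) ^ N) * pentV s (N - 1) := by
  have hq := norm_pow_lt_one hs two_ne_zero
  have hq0 : s ^ 2 ≠ 0 := pow_ne_zero 2 hs0
  have h1 : (s ^ 2) ^ N * pentV s (N - 1) = ∑' r : ℤ, ((-1) ^ r * s ^ (3 * r ^ 2 - r) *
      (s ^ 2) ^ (N + r) * (1 - (s ^ 2) ^ (N - r))) *
      (qcz (s ^ 2) (N - r) * qcz (s ^ 2) (N + r)) := by
    rw [pentV, ← tsum_mul_left]
    refine tsum_congr fun r => ?_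
    rw [show N - 1 - r = N - r - 1 by ring, ← qcz_sub_one hq (N - r),
      show N - 1 + 1 + r = N + r by ring]
    have : s ^ (3 * r ^ 2 - r) * (s ^ 2) ^ (N + r) = (s ^ 2) ^ N * s ^ (3 * r ^ 2 + r) := by
      rw [← zpow_natCast, ← zpow_mul, ← zpow_mul, ← zpow_add₀ hs0, ← zpow_add₀ hs0]
      congr 1; push_cast; ring
    linear_combination (-((-1) ^ r * (1 - (s ^ 2) ^ (N - r)) *
      (qcz (s ^ 2) (N - r) * qcz (s ^ 2) (N + r)))) * this
  have h2 : pentV s (N - 1) = ∑' r : ℤ, ((-1) ^ r * s ^ (3 * r ^ 2 - r) *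
      (1 - (s ^ 2) ^ (N + r))) * (qcz (s ^ 2) (N - r) * qcz (s ^ 2) (N + r)) := by
    rw [pentV, ← (Equiv.neg ℤ).tsum_eq]
    refine tsum_congr fun r => ?_
    simp only [Equiv.neg_apply, neg_one_zpow_neg]
    rw [show N - 1 - -r = N + r - 1 by ring, ← qcz_sub_one hq (N + r),
      show N - 1 + 1 + -r = N - r by ring, show 3 * (-r) ^ 2 + -r = 3 * r ^ 2 - r by ring]
    ring
  rw [add_mul, one_mul, h1, h2, ← (summable_qcz_mul _ _ _ _).tsum_add (summable_qcz_mul _ _ _ _),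
    pentU, ← tsum_mul_left]
  refine tsum_congr fun r => ?_
  rw [show 2 * N = (N + r) + (N - r) by ring, zpow_add₀ hq0]
  ring

/-- With `pentV_eq_pentU` the recurrence becomes that of 1/(q;q)_N once 1 + q^N is cancelled, and at
N = 0 only r = 0 contributes. -/
lemma pentU_eq {s : ℂ} (hs0 : s ≠ 0) (hs : ‖s‖ < 1) (N : ℕ) : pentU s N = qc (s ^ 2) N := by
  have hq := norm_pow_lt_one hs two_ne_zero
  induction N with
  | zero =>
    rw [pentU, tsum_eq_single 0]
    · simp [qcz, qc_zero]
    · intro r hr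
      rcases lt_or_gt_of_ne hr with h | h
      · rw [qcz_of_neg _ (by push_cast; omega : ((0 : ℕ) : ℤ) + r < 0)]; ring
      · rw [qcz_of_neg _ (by push_cast; omega : ((0 : ℕ) : ℤ) - r < 0)]; ring
  | succ N ih =>
    have h1 := pentU_rec hs0 hs (N + 1 : ℕ)
    rw [show ((N + 1 : ℕ) : ℤ) - 1 = (N : ℤ) by push_cast; ring, pentV_eq_pentU hs0 hs, ih,
      ← qc_succ hq N] at h1
    have h2 : (s ^ 2) ^ (2 * ((N + 1 : ℕ) : ℤ)) = (s ^ 2) ^ (N + 1) * (s ^ 2) ^ (N + 1) := by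
      rw [two_mul, zpow_add₀ (pow_ne_zero 2 hs0), zpow_natCast]
    rw [h2, zpow_natCast] at h1
    have h3 : 1 - (s ^ 2) ^ (N + 1) * (s ^ 2) ^ (N + 1) ≠ 0 := by
      have := one_sub_pow_ne_zero hq (2 * N + 1)
      rw [← pow_add, show N + 1 + (N + 1) = 2 * N + 1 + 1 by ring]
      exact this
    refine mul_left_cancel₀ h3 ?_
    linear_combination h1

lemma pentV_eq {s : ℂ} (hs0 : s ≠ 0) (hs : ‖s‖ < 1) (N : ℕ) : pentV s N = qc (s ^ 2) N := by
  rw [pentV_eq_pentU hs0 hs, pentU_eq hs0 hs]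

/-- Terms with N < a vanish; putting N = m + a leaves Cauchy's sum with parameter 2a + e. -/
lemma hasSum_cauchy_shift {s : ℂ} (hs0 : s ≠ 0) (hs : ‖s‖ < 1) (e a : ℕ) :
    HasSum (fun N : ℕ => (s ^ 2) ^ (N ^ 2 + e * N) *
        (qcz (s ^ 2) ((N : ℤ) - a) * qcz (s ^ 2) (N + e + a)))
      ((s ^ 2) ^ (a ^ 2 + e * a) * (qPochInf (s ^ 2) (s ^ 2))⁻¹) := by
  have hinj : Function.Injective (fun m : ℕ => m + a) := add_left_injective a
  rw [← hinj.hasSum_iff]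
  · refine hasSum_of_eq ((hasSum_cauchy hs0 hs (2 * a + e)).mul_left _) fun m => ?_
    simp only [Function.comp_apply]
    rw [show ((m + a : ℕ) : ℤ) - a = (m : ℤ) by push_cast; ring,
      show ((m + a : ℕ) : ℤ) + e + a = ((m + (2 * a + e) : ℕ) : ℤ) by push_cast; ring,
      qcz_natCast, qcz_natCast]
    ring
  · intro N hN
    have : N < a := by
      by_contra h
      exact hN ⟨N - a, by simp; omega⟩
    rw [qcz_of_neg _ (by omega : (N : ℤ) - a < 0)]
    ring

lemma exists_norm_qcz_le {q : ℂ} (hq : ‖q‖ < 1) : ∃ M : ℝ, 0 ≤ M ∧ ∀ k, ‖qcz q k‖ ≤ M := by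
  obtain ⟨M, hM, h⟩ := exists_norm_qc_le hq
  refine ⟨M, hM, fun k => ?_⟩
  unfold qcz
  split_ifs
  · exact h _
  · simpa using hM

/-- The limiting Bailey lemma: multiply the finite expansion of 1/(q;q)_N by q^(N²+eN), sum over N
and exchange the two summations. -/
lemma hasSum_rogers_ramanujan {s : ℂ} (hs : ‖s‖ < 1) (e : ℕ) {w B : ℤ → ℂ}
    (hw : Summable fun r => ‖w r‖)
    (hc : ∀ N : ℕ, HasSum (fun r : ℤ => w r * (qcz (s ^ 2) (N - r) * qcz (s ^ 2) (N + e + r)))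
      (qc (s ^ 2) N))
    (hB : ∀ r : ℤ, HasSum (fun N : ℕ => (s ^ 2) ^ (N ^ 2 + e * N) *
        (qcz (s ^ 2) (N - r) * qcz (s ^ 2) (N + e + r))) (B r)) :
    HasSum (fun r => w r * B r) (RR e (s ^ 2)) := by
  have hq := norm_pow_lt_one hs two_ne_zero
  obtain ⟨M, hM, hb⟩ := exists_norm_qcz_le hq
  have hS : Summable fun p : ℤ × ℕ => w p.1 * ((s ^ 2) ^ (p.2 ^ 2 + e * p.2) *
        (qcz (s ^ 2) (p.2 - p.1) * qcz (s ^ 2) (p.2 + e + p.1))) := by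
    have h2 : Summable fun p : ℤ × ℕ => ‖w p.1‖ * ‖s ^ 2‖ ^ p.2 :=
      hw.mul_of_nonneg (summable_geometric_of_lt_one (norm_nonneg _) hq)
        (fun _ => norm_nonneg _) (fun _ => by positivity)
    refine Summable.of_norm_bounded (h2.mul_right (M * M)) fun p => ?_
    have h3 : ‖(s ^ 2) ^ (p.2 ^ 2 + e * p.2)‖ ≤ ‖s ^ 2‖ ^ p.2 := by
      rw [norm_pow (s ^ 2) (p.2 ^ 2 + e * p.2)]
      exact pow_le_pow_of_le_one (norm_nonneg _) hq.le
          ((Nat.le_self_pow two_ne_zero _).trans (Nat.le_add_right _ _))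
    rw [norm_mul, norm_mul _ (_ * _), norm_mul (qcz _ _), mul_assoc]
    gcongr
    · exact hb _
    · exact hb _
  have h1 := hS.hasSum.prod_fiberwise fun r => (hB r).mul_left (w r)
  have h2 := ((Equiv.prodComm ℕ ℤ).hasSum_iff.mpr hS.hasSum).prod_fiberwise
    (g := fun N => (s ^ 2) ^ (N ^ 2 + e * N) * qc (s ^ 2) N) fun N => by
      refine hasSum_of_eq ((hc N).mul_left _) fun r => ?_
      simp only [Function.comp_apply, Equiv.prodComm_apply, Prod.swap]
      ring
  rw [(hasSum_RR e hq).unique h2]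
  exact h1

lemma rogers_ramanujan_zero_theta {s : ℂ} (hs0 : s ≠ 0) (hs : ‖s‖ < 1) :
    RR 0 (s ^ 2) = Theta (s ^ 5) (-s ^ 4) * (qPochInf (s ^ 2) (s ^ 2))⁻¹ := by
  have h := hasSum_rogers_ramanujan hs 0 (w := fun r => (-1) ^ r * s ^ (3 * r ^ 2 - r))
    (B := fun r => (s ^ 2) ^ (r ^ 2) * (qPochInf (s ^ 2) (s ^ 2))⁻¹) ?_ ?_ ?_
  · refine h.unique ?_
    refine hasSum_of_eq ((hasSum_theta (pow_ne_zero 5 hs0) (norm_pow_lt_one hs (by norm_num))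
      (neg_ne_zero.mpr (pow_ne_zero 4 hs0))).mul_right _) fun r => ?_
    have : s ^ (3 * r ^ 2 - r) * (s ^ 2) ^ (r ^ 2) = (s ^ 5) ^ (r ^ 2 - r) * (s ^ 4) ^ r := by
      simp only [← zpow_natCast, ← zpow_mul, ← zpow_add₀ hs0]
      congr 1; push_cast; ring
    rw [neg_eq_neg_one_mul, mul_zpow]
    linear_combination (-((-1) ^ r * (qPochInf (s ^ 2) (s ^ 2))⁻¹)) * this
  · refine Summable.of_nonneg_of_le (fun _ => norm_nonneg _) (fun r => ?_)
      (summable_theta hs0 hs one_ne_zero)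
    have : (2 * r ^ 2 : ℤ) = ((2 * r.natAbs ^ 2 : ℕ) : ℤ) := by push_cast; simp
    rw [one_zpow, mul_one, show 3 * r ^ 2 - r = (r ^ 2 - r) + 2 * r ^ 2 by ring, zpow_add₀ hs0, this,
      zpow_natCast, norm_mul, norm_mul, norm_zpow, norm_neg, norm_one, one_zpow, one_mul, norm_pow]
    exact mul_le_of_le_one_right (norm_nonneg _) (pow_le_one₀ (norm_nonneg _) hs.le)
  · intro N
    rw [← pentU_eq hs0 hs, pentU]
    convert (summable_qcz_mul _ _ _ _).hasSum using 5
    simp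
  · intro r
    -- The product of the two coefficients is symmetric under r ↦ -r, so Cauchy's sum for natural
    -- parameters suffices. For e = 1 the symmetry is r ↦ -1 - r.
    rcases Int.eq_nat_or_neg r with ⟨a, rfl | rfl⟩
    · convert hasSum_cauchy_shift hs0 hs 0 a using 2
      · rw [← zpow_natCast (s ^ 2) (a ^ 2 + 0 * a)]; simp
    · convert hasSum_cauchy_shift hs0 hs 0 a using 2 with N
      · simp only [Nat.cast_zero, add_zero, sub_neg_eq_add, ← sub_eq_add_neg]
        ring
      · rw [← zpow_natCast (s ^ 2) (a ^ 2 + 0 * a)]; simp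

lemma rogers_ramanujan_one_theta {s : ℂ} (hs0 : s ≠ 0) (hs : ‖s‖ < 1) :
    RR 1 (s ^ 2) = Theta (s ^ 5) (-s ^ 8) * (qPochInf (s ^ 2) (s ^ 2))⁻¹ := by
  have h := hasSum_rogers_ramanujan hs 1 (w := fun r => (-1) ^ r * s ^ (3 * r ^ 2 + r))
    (B := fun r => (s ^ 2) ^ (r ^ 2 + r) * (qPochInf (s ^ 2) (s ^ 2))⁻¹) ?_ ?_ ?_
  · refine h.unique ?_
    refine hasSum_of_eq ((hasSum_theta (pow_ne_zero 5 hs0) (norm_pow_lt_one hs (by norm_num))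
      (neg_ne_zero.mpr (pow_ne_zero 8 hs0))).mul_right _) fun r => ?_
    have : s ^ (3 * r ^ 2 + r) * (s ^ 2) ^ (r ^ 2 + r) = (s ^ 5) ^ (r ^ 2 - r) * (s ^ 8) ^ r := by
      simp only [← zpow_natCast, ← zpow_mul, ← zpow_add₀ hs0]
      congr 1; push_cast; ring
    rw [neg_eq_neg_one_mul, mul_zpow]
    linear_combination (-((-1) ^ r * (qPochInf (s ^ 2) (s ^ 2))⁻¹)) * this
  · refine Summable.of_nonneg_of_le (fun _ => norm_nonneg _) (fun r => ?_)
      (summable_theta hs0 hs (z := s ^ 2) (pow_ne_zero 2 hs0))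
    have : (2 * r ^ 2 : ℤ) = ((2 * r.natAbs ^ 2 : ℕ) : ℤ) := by push_cast; simp
    have e : s ^ (3 * r ^ 2 + r) = s ^ (r ^ 2 - r) * (s ^ 2) ^ r * s ^ (2 * r ^ 2) := by
      rw [← zpow_natCast s 2, ← zpow_mul, ← zpow_add₀ hs0, ← zpow_add₀ hs0]
      congr 1; push_cast; ring
    rw [e, this, zpow_natCast, norm_mul, norm_zpow, norm_neg, norm_one, one_zpow, one_mul,
      norm_mul _ (s ^ (2 * _)), norm_pow]
    exact mul_le_of_le_one_right (norm_nonneg _) (pow_le_one₀ (norm_nonneg _) hs.le)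
  · intro N
    rw [← pentV_eq hs0 hs, pentV]
    exact (summable_qcz_mul _ _ _ _).hasSum
  · intro r
    rcases le_or_gt 0 r with h | h
    · obtain ⟨a, rfl⟩ := Int.eq_ofNat_of_zero_le h
      convert hasSum_cauchy_shift hs0 hs 1 a using 2
      · rw [← zpow_natCast (s ^ 2) (a ^ 2 + 1 * a)]; simp
    · obtain ⟨a, rfl⟩ : ∃ a : ℕ, r = -((a : ℤ) + 1) := ⟨(-r - 1).toNat, by omega⟩
      convert hasSum_cauchy_shift hs0 hs 1 a using 2 with N
      · rw [show (N : ℤ) - -((a : ℤ) + 1) = N + (1 : ℕ) + a by push_cast; ring,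
          show (N : ℤ) + (1 : ℕ) + -((a : ℤ) + 1) = N - a by push_cast; ring]
        ring
      · rw [← zpow_natCast (s ^ 2) (a ^ 2 + 1 * a)]
        congr 1; push_cast; ring

/-! ### Rogers–Ramanujan identities in product form. -/

lemma exists_sq_eq {q : ℂ} (hq0 : q ≠ 0) (hq : ‖q‖ < 1) : ∃ s : ℂ, s ≠ 0 ∧ ‖s‖ < 1 ∧ s ^ 2 = q := by
  obtain ⟨s, rfl⟩ := IsAlgClosed.exists_pow_nat_eq q (n := 2) (by norm_num)
  refine ⟨s, fun h => hq0 (by simp [h]), ?_, rfl⟩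
  rw [norm_pow] at hq
  exact (pow_lt_one_iff_of_nonneg (norm_nonneg _) two_ne_zero).mp hq

lemma prod_qPochInf_five {q : ℂ} (hq : ‖q‖ < 1) :
    qPochInf q (q ^ 5) * qPochInf (q ^ 2) (q ^ 5) * qPochInf (q ^ 3) (q ^ 5) *
      qPochInf (q ^ 4) (q ^ 5) * qPochInf (q ^ 5) (q ^ 5) = qPochInf q q := by
  rw [← prod_qPochInf_residues q hq (m := 5) (by norm_num)]
  simp only [Finset.prod_range_succ, Finset.prod_range_zero, ← pow_succ', one_mul, zero_add, pow_one,
    Nat.reduceAdd]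

lemma qPochInf_pow_ne_zero {q : ℂ} (hq : ‖q‖ < 1) {a b : ℕ} (ha : a ≠ 0) (hb : b ≠ 0) :
    qPochInf (q ^ a) (q ^ b) ≠ 0 :=
  qPochInf_ne_zero_of_norm_lt (norm_pow_lt_one hq hb) (norm_pow_lt_one hq ha)

/-- The first Rogers–Ramanujan identity. -/
theorem rogers_ramanujan_zero {q : ℂ} (hq0 : q ≠ 0) (hq : ‖q‖ < 1) :
    RR 0 q = (modTheta q (q ^ 5))⁻¹ := by
  obtain ⟨s, hs0, hs, rfl⟩ := exists_sq_eq hq0 hq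
  rw [rogers_ramanujan_zero_theta hs0 hs, jacobi_triple (pow_ne_zero 5 hs0)
    (norm_pow_lt_one hs (by norm_num)), ← prod_qPochInf_five hq, modTheta]
  · have e1 : (s ^ 2) ^ 5 / s ^ 2 = (s ^ 2) ^ 4 := by field_simp
    have e2 : -((s ^ 5) ^ 2 / -s ^ 4) = (s ^ 2) ^ 3 := by field_simp
    have e3 : (s ^ 5) ^ 2 = (s ^ 2) ^ 5 := by ring
    have e4 : - -s ^ 4 = (s ^ 2) ^ 2 := by ring
    rw [e1, e2, e3, e4]
    have h1 := qPochInf_pow_ne_zero hq (a := 1) (b := 5) (by norm_num) (by norm_num)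
    have h2 := qPochInf_pow_ne_zero hq (a := 2) (b := 5) (by norm_num) (by norm_num)
    have h3 := qPochInf_pow_ne_zero hq (a := 3) (b := 5) (by norm_num) (by norm_num)
    have h4 := qPochInf_pow_ne_zero hq (a := 4) (b := 5) (by norm_num) (by norm_num)
    have h5 := qPochInf_pow_ne_zero hq (a := 5) (b := 5) (by norm_num) (by norm_num)
    rw [pow_one] at h1

    generalize qPochInf (s ^ 2) ((s ^ 2) ^ 5) = A at h1 ⊢
    generalize qPochInf ((s ^ 2) ^ 2) ((s ^ 2) ^ 5) = A at h2 ⊢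
    generalize qPochInf ((s ^ 2) ^ 3) ((s ^ 2) ^ 5) = A at h3 ⊢
    generalize qPochInf ((s ^ 2) ^ 4) ((s ^ 2) ^ 5) = A at h4 ⊢
    generalize qPochInf ((s ^ 2) ^ 5) ((s ^ 2) ^ 5) = A at h5 ⊢
    field_simp
  · rw [norm_neg, norm_pow, norm_pow, norm_pow, ← pow_mul]
    exact pow_lt_pow_right_of_lt_one₀ (norm_pos_iff.mpr hs0) hs (by norm_num)

/-- The second Rogers–Ramanujan identity. -/
theorem rogers_ramanujan_one {q : ℂ} (hq0 : q ≠ 0) (hq : ‖q‖ < 1) :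
    RR 1 q = (modTheta (q ^ 2) (q ^ 5))⁻¹ := by
  obtain ⟨s, hs0, hs, rfl⟩ := exists_sq_eq hq0 hq
  rw [rogers_ramanujan_one_theta hs0 hs, jacobi_triple (pow_ne_zero 5 hs0)
    (norm_pow_lt_one hs (by norm_num)), ← prod_qPochInf_five hq, modTheta]
  · have e1 : (s ^ 2) ^ 5 / (s ^ 2) ^ 2 = (s ^ 2) ^ 3 := by field_simp
    have e2 : -((s ^ 5) ^ 2 / -s ^ 8) = s ^ 2 := by field_simp
    have e3 : (s ^ 5) ^ 2 = (s ^ 2) ^ 5 := by ring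
    have e4 : - -s ^ 8 = (s ^ 2) ^ 4 := by ring
    rw [e1, e2, e3, e4]
    have h1 := qPochInf_pow_ne_zero hq (a := 1) (b := 5) (by norm_num) (by norm_num)
    have h2 := qPochInf_pow_ne_zero hq (a := 2) (b := 5) (by norm_num) (by norm_num)
    have h3 := qPochInf_pow_ne_zero hq (a := 3) (b := 5) (by norm_num) (by norm_num)
    have h4 := qPochInf_pow_ne_zero hq (a := 4) (b := 5) (by norm_num) (by norm_num)
    have h5 := qPochInf_pow_ne_zero hq (a := 5) (b := 5) (by norm_num) (by norm_num)
    rw [pow_one] at h1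
    generalize qPochInf (s ^ 2) ((s ^ 2) ^ 5) = A at h1 ⊢
    generalize qPochInf ((s ^ 2) ^ 2) ((s ^ 2) ^ 5) = A at h2 ⊢
    generalize qPochInf ((s ^ 2) ^ 3) ((s ^ 2) ^ 5) = A at h3 ⊢
    generalize qPochInf ((s ^ 2) ^ 4) ((s ^ 2) ^ 5) = A at h4 ⊢
    generalize qPochInf ((s ^ 2) ^ 5) ((s ^ 2) ^ 5) = A at h5 ⊢
    field_simp
  · rw [norm_neg, norm_pow, norm_pow, norm_pow, ← pow_mul]
    exact pow_lt_pow_right_of_lt_one₀ (norm_pos_iff.mpr hs0) hs (by norm_num)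

/-! ### Theta constants as quotients of Euler products. -/

/-- The Euler product `(q; q)`. -/
noncomputable def eulerP (q : ℂ) : ℂ := qPochInf q q

lemma eulerP_pow_ne_zero {q : ℂ} (hq : ‖q‖ < 1) {k : ℕ} (hk : k ≠ 0) : eulerP (q ^ k) ≠ 0 :=
  qPochInf_pow_ne_zero hq hk hk

lemma eulerP_ne_zero {q : ℂ} (hq : ‖q‖ < 1) : eulerP q ≠ 0 :=
  qPochInf_ne_zero_of_norm_lt hq hq

lemma qPochInf_odd_mul {q : ℂ} (hq : ‖q‖ < 1) : qPochInf q (q ^ 2) * eulerP (q ^ 2) = eulerP q := by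
  rw [eulerP, eulerP, ← prod_qPochInf_residues q hq two_ne_zero]
  simp [Finset.prod_range_succ, pow_two]

lemma qPochInf_odd {q : ℂ} (hq : ‖q‖ < 1) : qPochInf q (q ^ 2) = eulerP q / eulerP (q ^ 2) :=
  eq_div_of_mul_eq (eulerP_pow_ne_zero hq two_ne_zero) (qPochInf_odd_mul hq)

lemma qPochInf_neg {q : ℂ} (hq : ‖q‖ < 1) : qPochInf (-q) q = eulerP (q ^ 2) / eulerP q := by
  refine eq_div_of_mul_eq (eulerP_ne_zero hq) ?_
  rw [mul_comm]
  exact qPochInf_mul_neg q hq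

lemma qPochInf_neg_odd {q : ℂ} (hq : ‖q‖ < 1) :
    qPochInf (-q) (q ^ 2) = eulerP (q ^ 2) ^ 2 / (eulerP q * eulerP (q ^ 4)) := by
  have h1 := qPochInf_mul_neg q (norm_pow_lt_one hq two_ne_zero)
  rw [qPochInf_odd hq, qPochInf_odd (norm_pow_lt_one hq two_ne_zero),
    show (q ^ 2) ^ 2 = q ^ 4 by ring] at h1
  have h2 := eulerP_ne_zero hq
  have h3 := eulerP_pow_ne_zero hq two_ne_zero
  have h4 := eulerP_pow_ne_zero hq four_ne_zero
  field_simp at h1 ⊢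
  linear_combination h1

lemma Theta_shift {s : ℂ} (hs0 : s ≠ 0) {z : ℂ} (hz : z ≠ 0) :
    Theta s z = z * Theta s (z * s ^ 2) := by
  rw [Theta, Theta, ← tsum_mul_left, ← (Equiv.addRight (1 : ℤ)).tsum_eq]
  refine tsum_congr fun n => ?_
  simp only [Equiv.coe_addRight]
  have : s ^ ((n + 1) ^ 2 - (n + 1)) = s ^ (n ^ 2 - n) * (s ^ 2) ^ n := by
    rw [← zpow_natCast, ← zpow_mul, ← zpow_add₀ hs0]
    congr 1; push_cast; ring
  rw [this, zpow_add_one₀ hz, mul_zpow]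
  ring

lemma Theta_self {q : ℂ} (hq0 : q ≠ 0) (hq : ‖q‖ < 1) :
    Theta q q = eulerP (q ^ 2) ^ 5 / (eulerP q ^ 2 * eulerP (q ^ 4) ^ 2) := by
  rw [jacobi_triple hq0 hq, show -(q ^ 2 / q) = -q by field_simp, qPochInf_neg_odd hq, ← eulerP]
  · ring
  · rw [norm_pow]
    exact pow_lt_self_of_lt_one₀ (norm_pos_iff.mpr hq0) hq one_lt_two

lemma Theta_sq {q : ℂ} (hq0 : q ≠ 0) (hq : ‖q‖ < 1) :
    Theta q (q ^ 2) = 2 * eulerP (q ^ 4) ^ 2 / eulerP (q ^ 2) := by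
  have hq2 := norm_pow_lt_one hq two_ne_zero
  -- The point z = q² lies on the boundary excluded by `jacobi_triple`; the shift moves it to z = 1,
  -- where the factor 1 - (-1) supplies the 2.
  have h1 := Theta_shift hq0 one_ne_zero
  rw [one_mul, one_mul] at h1
  rw [← h1, jacobi_triple hq0 hq (by simpa using hq2), qPochInf_step (-1) hq2, div_one, neg_one_mul,
    qPochInf_neg hq2, ← eulerP, show (q ^ 2) ^ 2 = q ^ 4 by ring]
  have h3 := eulerP_pow_ne_zero hq two_ne_zero
  field_simp
  ring

lemma Theta_cube {q : ℂ} (hq0 : q ≠ 0) : Theta q (q ^ 3) = q⁻¹ * Theta q q := by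
  rw [Theta_shift hq0 hq0, show q * q ^ 2 = q ^ 3 by ring]
  field_simp

lemma Theta_self_ne_zero {q : ℂ} (hq0 : q ≠ 0) (hq : ‖q‖ < 1) : Theta q q ≠ 0 := by
  rw [Theta_self hq0 hq]
  have h2 := eulerP_ne_zero hq
  have h3 := eulerP_pow_ne_zero hq two_ne_zero
  have h4 := eulerP_pow_ne_zero hq four_ne_zero
  positivity

/-! ### Closed forms of the bilateral series. -/

lemma zpow_sq_sub_mul {q : ℂ} (hq0 : q ≠ 0) (j e : ℕ) :
    q ^ ((j : ℤ) ^ 2 - j) * (q ^ (e + 1)) ^ j = q ^ (j ^ 2 + e * j) := by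
  rw [← pow_mul, ← zpow_natCast, ← zpow_natCast, ← zpow_add₀ hq0]
  congr 1; push_cast; ring

lemma zpow_sq_mul {q : ℂ} (hq0 : q ≠ 0) (j e : ℕ) :
    q ^ ((j : ℤ) ^ 2) * (q ^ e) ^ j = q ^ (j ^ 2 + e * j) := by
  rw [← pow_mul, ← zpow_natCast, ← zpow_natCast, ← zpow_add₀ hq0]
  congr 1

lemma hasSum_of_value {ι : Type*} {f : ι → ℂ} {a b : ℂ} (h : HasSum f a) (hab : b = a) :
    HasSum f b := hab ▸ h

lemma summable_qc_subseq {q : ℂ} (hq : ‖q‖ < 1) (e : ℕ) (g : ℕ → ℕ) :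
    Summable fun j : ℕ => q ^ (j ^ 2 + e * j) * qc q (g j) := by
  obtain ⟨M, hM, hc⟩ := exists_norm_qc_le hq
  refine Summable.of_norm_bounded
    ((summable_geometric_of_lt_one (norm_nonneg q) hq).mul_right M) fun n => ?_
  rw [norm_mul, norm_pow]
  refine mul_le_mul ?_ (hc _) (norm_nonneg _) (by positivity)
  exact pow_le_pow_of_le_one (norm_nonneg _) hq.le
    ((Nat.le_self_pow two_ne_zero n).trans (Nat.le_add_right _ _))

/-- The bilateral series `∑ q^(n²) (b q^n; q)`. -/
lemma hasSum_square {s : ℂ} (hs0 : s ≠ 0) (hs : ‖s‖ < 1) {q : ℂ} (hqs : s ^ 2 = q) {b : ℂ} {e : ℕ}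
    (hb : b ^ 2 = q ^ (e + 1)) {A B : ℂ}
    (hA : HasSum (fun j : ℕ => q ^ (j ^ 2 + e * j) * qc q (2 * j)) A)
    (hB : HasSum (fun j : ℕ => q ^ (j ^ 2 + (e + 1) * j) * qc q (2 * j + 1)) B) :
    HasSum (fun n : ℤ => q ^ (n ^ 2) * qPochInf (b * q ^ n) q)
      (Theta q q * A - b * (Theta q (q ^ 2) * B)) := by
  subst hqs
  have hq0 : s ^ 2 ≠ 0 := pow_ne_zero 2 hs0
  have hb0 : b ≠ 0 := fun h => pow_ne_zero (e + 1) hq0 (by rw [← hb, h]; simp)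
  have h := hasSum_two_psi_two hs0 hs hb0 one_ne_zero
    (hasSum_of_eq hA fun j => ?_) (hasSum_of_eq hB fun j => ?_)
  · simpa using h
  · rw [← zpow_sq_sub_mul hq0, hb, div_one]
  · rw [← zpow_sq_mul hq0, hb, div_one]

/-- The bilateral series `∑ q^(n² + n) (b q^n; q)`. -/
lemma hasSum_pronic {s : ℂ} (hs0 : s ≠ 0) (hs : ‖s‖ < 1) {q : ℂ} (hqs : s ^ 2 = q) {b : ℂ} {e : ℕ}
    (hb : b ^ 2 = q ^ (e + 2)) {A B : ℂ}
    (hA : HasSum (fun j : ℕ => q ^ (j ^ 2 + e * j) * qc q (2 * j)) A)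
    (hB : HasSum (fun j : ℕ => q ^ (j ^ 2 + (e + 1) * j) * qc q (2 * j + 1)) B) :
    HasSum (fun n : ℤ => q ^ (n ^ 2 + n) * qPochInf (b * q ^ n) q)
      (Theta q (q ^ 2) * A - b * (q⁻¹ * Theta q q * B)) := by
  subst hqs
  have hq0 : s ^ 2 ≠ 0 := pow_ne_zero 2 hs0
  have hb0 : b ≠ 0 := fun h => pow_ne_zero (e + 2) hq0 (by rw [← hb, h]; simp)
  have hbq : b ^ 2 / s ^ 2 = (s ^ 2) ^ (e + 1) := by
    rw [hb, pow_succ _ (e + 1), mul_div_cancel_right₀ _ hq0]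
  have h := hasSum_two_psi_two hs0 hs hb0 hq0
    (hasSum_of_eq hA fun j => ?_) (hasSum_of_eq hB fun j => ?_)
  · rw [← Theta_cube hq0, show (s ^ 2) ^ 3 = s ^ 2 * (s ^ 2) ^ 2 by ring, sq (s ^ 2)]
    refine hasSum_of_eq (by rw [sq (s ^ 2)] at h; exact h) fun n => ?_
    rw [zpow_add₀ hq0]
  · rw [← zpow_sq_sub_mul hq0, hbq]
  · rw [← zpow_sq_mul hq0, hbq]

/-- Evaluation of `∑ q^(n² + n) / (q; q)_{2n}`. -/
lemma hasSum_square_even {q : ℂ} (hq0 : q ≠ 0) (hq : ‖q‖ < 1) :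
    HasSum (fun j : ℕ => q ^ (j ^ 2 + 1 * j) * qc q (2 * j))
      ((eulerP q * RR 0 q + q * (Theta q (q ^ 2) * (RR 1 (q ^ 4) / qPochInf q (q ^ 2)))) /
        Theta q q) := by
  obtain ⟨s, hs0, hs, hsq⟩ := exists_sq_eq hq0 hq
  have hA := (summable_qc_subseq hq 1 (fun j => 2 * j)).hasSum
  -- At b = q the bilateral sum is (q;q) times the first Rogers–Ramanujan series, so the parity
  -- formula is a linear equation for the unknown even sum.
  have h1 := hasSum_nat_of_bilateral hq0 hq
    (hasSum_square hs0 hs hsq (b := q) (e := 1) (by ring) hA (hasSum_rogers_odd hq0 hq))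
  have h2 := h1.unique (hasSum_of_eq ((hasSum_RR 0 hq).mul_left (eulerP q)) fun n => by
    rw [← zpow_natCast q (n ^ 2 + 0 * n), eulerP]; simp)
  have h3 := Theta_self_ne_zero hq0 hq
  refine hasSum_of_value hA ?_
  rw [div_eq_iff h3]
  linear_combination -h2

/-- Evaluation of `∑ q^(n² + n) / (q; q)_{2n+1}`. -/
lemma hasSum_pronic_odd {q : ℂ} (hq0 : q ≠ 0) (hq : ‖q‖ < 1) :
    HasSum (fun j : ℕ => q ^ (j ^ 2 + 1 * j) * qc q (2 * j + 1))
      ((Theta q (q ^ 2) * (RR 0 (q ^ 4) / qPochInf q (q ^ 2)) - eulerP q * RR 1 q) /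
        Theta q q) := by
  obtain ⟨s, hs0, hs, hsq⟩ := exists_sq_eq hq0 hq
  have hB := (summable_qc_subseq hq 1 (fun j => 2 * j + 1)).hasSum
  have hA : HasSum (fun j : ℕ => q ^ (j ^ 2 + 0 * j) * qc q (2 * j))
      (RR 0 (q ^ 4) / qPochInf q (q ^ 2)) := by simpa using hasSum_rogers_even hq0 hq
  have h1 := hasSum_nat_of_bilateral hq0 hq
    (hasSum_pronic hs0 hs hsq (b := q) (e := 0) (by ring) hA hB)
  have h2 := h1.unique (hasSum_of_eq ((hasSum_RR 1 hq).mul_left (eulerP q)) fun n => by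
    rw [← zpow_natCast q (n ^ 2 + 1 * n), eulerP]; simp)
  have h3 := Theta_self_ne_zero hq0 hq
  refine hasSum_of_value hB ?_
  rw [div_eq_iff h3]
  field_simp at h2 ⊢
  linear_combination h2

/-- Passing from b = q to b = -q only changes the sign of the odd part. The value is thus (q;q)
times the first Rogers–Ramanujan series plus twice the odd part, all over (-q;q). -/
lemma hasSum_f_zero {q : ℂ} (hq0 : q ≠ 0) (hq : ‖q‖ < 1) :
    HasSum (fun n : ℤ => q ^ (n ^ 2) * (qPochInf (-q * q ^ n) q / qPochInf (-q) q))
      (eulerP q ^ 2 / eulerP (q ^ 2) * RR 0 q +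
        4 * q * (eulerP (q ^ 4) ^ 2 / eulerP (q ^ 2) * RR 1 (q ^ 4))) := by
  obtain ⟨s, hs0, hs, hsq⟩ := exists_sq_eq hq0 hq
  have h1 := (hasSum_square hs0 hs hsq (b := -q) (e := 1) (by ring) (hasSum_square_even hq0 hq)
    (hasSum_rogers_odd hq0 hq)).div_const (qPochInf (-q) q)
  simp only [mul_div_assoc] at h1 ⊢
  refine hasSum_of_value h1 ?_
  have h2 := eulerP_ne_zero hq
  have h3 := eulerP_pow_ne_zero hq two_ne_zero
  have h4 := eulerP_pow_ne_zero hq four_ne_zero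
  rw [mul_div_cancel₀ _ (Theta_self_ne_zero hq0 hq), qPochInf_neg hq, qPochInf_odd hq,
    Theta_sq hq0 hq]
  field_simp
  ring

/-- Again b = -q against b = q, but now the even part is the known Rogers sum: the value is twice
the even part minus (q;q) times the second Rogers–Ramanujan series, over (-q;q). -/
lemma hasSum_f_one {q : ℂ} (hq0 : q ≠ 0) (hq : ‖q‖ < 1) :
    HasSum (fun n : ℤ => q ^ (n ^ 2 + n) * (qPochInf (-q * q ^ n) q / qPochInf (-q) q))
      (-(eulerP q ^ 2 / eulerP (q ^ 2) * RR 1 q) +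
        4 * (eulerP (q ^ 4) ^ 2 / eulerP (q ^ 2) * RR 0 (q ^ 4))) := by
  obtain ⟨s, hs0, hs, hsq⟩ := exists_sq_eq hq0 hq
  have hA : HasSum (fun j : ℕ => q ^ (j ^ 2 + 0 * j) * qc q (2 * j))
      (RR 0 (q ^ 4) / qPochInf q (q ^ 2)) := by simpa using hasSum_rogers_even hq0 hq
  have h1 := (hasSum_pronic hs0 hs hsq (b := -q) (e := 0) (by ring) hA
    (hasSum_pronic_odd hq0 hq)).div_const (qPochInf (-q) q)
  simp only [mul_div_assoc] at h1 ⊢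
  refine hasSum_of_value h1 ?_
  have h2 := eulerP_ne_zero hq
  have h3 := eulerP_pow_ne_zero hq two_ne_zero
  have h4 := eulerP_pow_ne_zero hq four_ne_zero
  have h5 := Theta_self_ne_zero hq0 hq
  rw [qPochInf_neg hq, qPochInf_odd hq, Theta_sq hq0 hq]
  field_simp
  ring

lemma hasSum_F_zero {q : ℂ} (hq0 : q ≠ 0) (hq : ‖q‖ < 1) :
    HasSum (fun n : ℤ => (q ^ 2) ^ (n ^ 2) *
        (qPochInf (q * (q ^ 2) ^ n) (q ^ 2) / qPochInf q (q ^ 2)))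
      (eulerP (q ^ 4) ^ 6 / (eulerP q * eulerP (q ^ 2) ^ 2 * eulerP (q ^ 8) ^ 2) * RR 0 (q ^ 8) +
        2 * q * (eulerP (q ^ 2) ^ 4 * eulerP (q ^ 8) ^ 4 / (eulerP q * eulerP (q ^ 4) ^ 6) *
          RR 1 (q ^ 2)) -
        4 * q * (eulerP (q ^ 2) ^ 2 * eulerP (q ^ 8) ^ 6 / (eulerP q * eulerP (q ^ 4) ^ 6) *
          RR 0 (q ^ 8))) := by
  have hQ0 : q ^ 2 ≠ 0 := pow_ne_zero 2 hq0
  have hQ := norm_pow_lt_one hq two_ne_zero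
  have hA : HasSum (fun j : ℕ => (q ^ 2) ^ (j ^ 2 + 0 * j) * qc (q ^ 2) (2 * j))
      (RR 0 ((q ^ 2) ^ 4) / qPochInf (q ^ 2) ((q ^ 2) ^ 2)) := by
    simpa using hasSum_rogers_even hQ0 hQ
  have h1 := (hasSum_square hq0 hq rfl (b := q) (e := 0) (by ring) hA
    (hasSum_pronic_odd hQ0 hQ)).div_const (qPochInf q (q ^ 2))
  simp only [mul_div_assoc] at h1 ⊢
  refine hasSum_of_value h1 ?_
  have h2 := eulerP_ne_zero hq
  have h3 := eulerP_pow_ne_zero hq two_ne_zero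
  have h4 := eulerP_pow_ne_zero hq four_ne_zero
  have h8 := eulerP_pow_ne_zero hq (k := 8) (by norm_num)
  rw [qPochInf_odd hq, qPochInf_odd hQ, Theta_sq hQ0 hQ, Theta_self hQ0 hQ]
  simp only [← pow_mul, Nat.reduceMul]
  field_simp
  ring

lemma hasSum_F_one {q : ℂ} (hq0 : q ≠ 0) (hq : ‖q‖ < 1) :
    HasSum (fun n : ℤ => (q ^ 2) ^ (n ^ 2 + n) *
        (qPochInf (q ^ 3 * (q ^ 2) ^ n) (q ^ 2) / qPochInf q (q ^ 2)))
      (-(q * (eulerP (q ^ 4) ^ 6 / (eulerP q * eulerP (q ^ 2) ^ 2 * eulerP (q ^ 8) ^ 2) *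
          RR 1 (q ^ 8))) +
        2 * (eulerP (q ^ 2) ^ 4 * eulerP (q ^ 8) ^ 4 / (eulerP q * eulerP (q ^ 4) ^ 6) *
          RR 0 (q ^ 2)) +
        4 * q ^ 2 * (eulerP (q ^ 2) ^ 2 * eulerP (q ^ 8) ^ 6 / (eulerP q * eulerP (q ^ 4) ^ 6) *
          RR 1 (q ^ 8))) := by
  have hQ0 : q ^ 2 ≠ 0 := pow_ne_zero 2 hq0
  have hQ := norm_pow_lt_one hq two_ne_zero
  have h1 := (hasSum_pronic hq0 hq rfl (b := q ^ 3) (e := 1) (by ring) (hasSum_square_even hQ0 hQ)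
    (hasSum_rogers_odd hQ0 hQ)).div_const (qPochInf q (q ^ 2))
  simp only [mul_div_assoc] at h1 ⊢
  refine hasSum_of_value h1 ?_
  have h2 := eulerP_ne_zero hq
  have h3 := eulerP_pow_ne_zero hq two_ne_zero
  have h4 := eulerP_pow_ne_zero hq four_ne_zero
  have h8 := eulerP_pow_ne_zero hq (k := 8) (by norm_num)
  rw [qPochInf_odd hq, qPochInf_odd hQ, Theta_sq hQ0 hQ, Theta_self hQ0 hQ]
  simp only [← pow_mul, Nat.reduceMul]
  field_simp
  ring

/-- The ₁ψ₁ limit in base q² at z = q, b = -q². The denominators are (q;q²) from -b/z and (-q²;q²)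
from the normalization; for `hasSum_psi` the two exchange roles, hence the equal values. -/
lemma hasSum_phi {q : ℂ} (hq0 : q ≠ 0) (hq : ‖q‖ < 1) :
    HasSum (fun n : ℤ => q ^ (n ^ 2) *
        (qPochInf (-q ^ 2 * (q ^ 2) ^ n) (q ^ 2) / qPochInf (-q ^ 2) (q ^ 2)))
      (eulerP (q ^ 2) ^ 7 / (eulerP q ^ 3 * eulerP (q ^ 4) ^ 3)) := by
  have hQ := norm_pow_lt_one hq two_ne_zero
  have h1 := (hasSum_one_psi_one hq0 hq (b := -q ^ 2) (z := q) hq0 (by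
    rw [norm_neg, norm_pow]
    exact pow_lt_self_of_lt_one₀ (norm_pos_iff.mpr hq0) hq one_lt_two)).div_const
    (qPochInf (-q ^ 2) (q ^ 2))
  have e : ∀ n : ℤ, q ^ (n ^ 2 - n) * q ^ n = q ^ (n ^ 2) := fun n => by
    rw [← zpow_add₀ hq0]; simp
  simp only [mul_div_assoc, e] at h1 ⊢
  refine hasSum_of_value h1 ?_
  have h2 := eulerP_ne_zero hq
  have h3 := eulerP_pow_ne_zero hq two_ne_zero
  have h4 := eulerP_pow_ne_zero hq four_ne_zero
  rw [show -(-q ^ 2 / q) = q by field_simp, qPochInf_odd hq, qPochInf_neg hQ, Theta_self hq0 hq]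
  simp only [← pow_mul, Nat.reduceMul]
  field_simp

lemma hasSum_psi {q : ℂ} (hq0 : q ≠ 0) (hq : ‖q‖ < 1) :
    HasSum (fun n : ℤ => q ^ (n ^ 2) *
        (qPochInf (q ^ 3 * (q ^ 2) ^ n) (q ^ 2) / qPochInf q (q ^ 2)))
      (eulerP (q ^ 2) ^ 7 / (eulerP q ^ 3 * eulerP (q ^ 4) ^ 3)) := by
  have hQ := norm_pow_lt_one hq two_ne_zero
  have h1 := (hasSum_one_psi_one hq0 hq (b := q ^ 3) (z := q) hq0 (by
    rw [norm_pow]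
    exact pow_lt_self_of_lt_one₀ (norm_pos_iff.mpr hq0) hq (by norm_num))).div_const
    (qPochInf q (q ^ 2))
  have e : ∀ n : ℤ, q ^ (n ^ 2 - n) * q ^ n = q ^ (n ^ 2) := fun n => by
    rw [← zpow_add₀ hq0]; simp
  simp only [mul_div_assoc, e] at h1 ⊢
  refine hasSum_of_value h1 ?_
  have h2 := eulerP_ne_zero hq
  have h3 := eulerP_pow_ne_zero hq two_ne_zero
  have h4 := eulerP_pow_ne_zero hq four_ne_zero
  rw [show -(q ^ 3 / q) = -q ^ 2 by field_simp, qPochInf_odd hq, qPochInf_neg hQ, Theta_self hq0 hq]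
  simp only [← pow_mul, Nat.reduceMul]
  field_simp

/-! ### Negative indices and the one-sided series. -/

lemma qPochInv_natCast (x p : ℂ) (n : ℕ) : qPochInv x p n = 1 / qPoch x p n := by
  simp [qPochInv]

lemma qPochInv_eq {x p : ℂ} (hp0 : p ≠ 0) (hp : ‖p‖ < 1) (hx : qPochInf x p ≠ 0) (n : ℤ) :
    qPochInv x p n = qPochInf (x * p ^ n) p / qPochInf x p := by
  rcases le_or_gt 0 n with h | h
  · obtain ⟨m, rfl⟩ := Int.eq_ofNat_of_zero_le h
    have h1 := qPoch_mul_qPochInf x hp m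
    rw [qPochInv_natCast, zpow_natCast]
    rw [← h1] at hx ⊢
    have h2 := left_ne_zero_of_mul hx
    have h3 := right_ne_zero_of_mul hx
    field_simp
  · obtain ⟨m, rfl⟩ : ∃ m : ℕ, n = -(m : ℤ) := ⟨(-n).toNat, by omega⟩
    have h1 := qPoch_mul_qPochInf (p ^ (-(m : ℤ)) * x) hp m
    have h2 : p ^ (-(m : ℤ)) * x * p ^ m = x := by
      rw [zpow_neg, zpow_natCast]
      field_simp
    rw [h2] at h1
    rw [qPochInv, if_neg (by omega), mul_comm x, ← h1, neg_neg, Int.toNat_natCast]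
    field_simp

lemma qPochInv_sub_one {x p : ℂ} (hp0 : p ≠ 0) (hp : ‖p‖ < 1) (hx : qPochInf x p ≠ 0) (n : ℤ) :
    qPochInv x p (n - 1) = (1 - x * p ^ (n - 1)) * qPochInv x p n := by
  rw [qPochInv_eq hp0 hp hx, qPochInv_eq hp0 hp hx, qPochInf_step _ hp, mul_assoc x,
    ← zpow_add_one₀ hp0, sub_add_cancel, mul_div_assoc]

/-- The reflected product is ∏ (1 + p^(-i)) over 0 ≤ i ≤ m. The factor i = 0 is the 2 in front of
the companion series; each other factor is p^(-i) (1 + p^i). -/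
lemma qPochInv_neg_self {p : ℂ} (hp0 : p ≠ 0) (hp : ‖p‖ < 1) (m : ℕ) :
    p ^ ((m + 1).choose 2) * qPochInv (-p) p (-((m : ℤ) + 1)) = 2 * qPoch (-p) p m := by
  have hx : qPochInf (-p) p ≠ 0 := qPochInf_ne_zero_of_norm_lt hp (by rwa [norm_neg])
  induction m with
  | zero =>
    have h := qPochInv_sub_one hp0 hp hx 0
    simp only [Nat.cast_zero, zero_add, zero_sub] at h ⊢
    rw [h]
    have h0 : qPochInv (-p) p 0 = 1 := by simpa [qPoch] using qPochInv_natCast (-p) p 0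
    rw [h0]
    simp [qPoch_zero, hp0]
    norm_num
  | succ m ih =>
    have h := qPochInv_sub_one hp0 hp hx (-((m : ℤ) + 1))
    rw [show -(((m + 1 : ℕ) : ℤ) + 1) = -((m : ℤ) + 1) - 1 by push_cast; ring, h, qPoch_succ,
      Nat.choose_succ_succ' (m + 1) 1, Nat.choose_one_right, pow_add]
    have e : p ^ (m + 1) * (p * p ^ (-((m : ℤ) + 1) - 1)) = 1 := by
      rw [← zpow_natCast, ← zpow_one_add₀ hp0, ← zpow_add₀ hp0]
      simp
    linear_combination (p ^ (m + 1) + p ^ (m + 1) * (p * p ^ (-((m : ℤ) + 1) - 1))) * ih +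
      2 * qPoch (-p) p m * e

/-- Each factor 1 - q^(-(2i-1)) equals -q^(-(2i-1)) (1 - q^(2i-1)), and the odd numbers up to 2m - 1
add up to m². -/
lemma qPochInv_odd {q : ℂ} (hq0 : q ≠ 0) (hq : ‖q‖ < 1) (m : ℕ) :
    q ^ (m ^ 2) * qPochInv q (q ^ 2) (-(m : ℤ)) = (-1) ^ m * qPoch q (q ^ 2) m := by
  have hp0 : q ^ 2 ≠ 0 := pow_ne_zero 2 hq0
  have hp := norm_pow_lt_one hq two_ne_zero
  have hx : qPochInf q (q ^ 2) ≠ 0 := qPochInf_ne_zero_of_norm_lt hp hq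
  induction m with
  | zero =>
    have h0 : qPochInv q (q ^ 2) 0 = 1 := by simpa [qPoch] using qPochInv_natCast q (q ^ 2) 0
    simp [h0, qPoch_zero]
  | succ m ih =>
    have h := qPochInv_sub_one hp0 hp hx (-(m : ℤ))
    rw [show -((m + 1 : ℕ) : ℤ) = -(m : ℤ) - 1 by push_cast; ring, h, qPoch_succ,
      show (m + 1) ^ 2 = m ^ 2 + (2 * m + 1) by ring, pow_add]
    have e : q ^ (2 * m + 1) * (q * (q ^ 2) ^ (-(m : ℤ) - 1)) = 1 := by
      rw [← zpow_natCast q 2, ← zpow_mul, ← zpow_natCast, ← zpow_one_add₀ hq0, ← zpow_add₀ hq0]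
      convert zpow_zero q using 2
      push_cast; ring
    have e2 : q * (q ^ 2) ^ m = q ^ (2 * m + 1) := by ring
    rw [e2]
    linear_combination (q ^ (2 * m + 1) - q ^ (2 * m + 1) * (q * (q ^ 2) ^ (-(m : ℤ) - 1))) * ih -
      (-1) ^ m * qPoch q (q ^ 2) m * e

lemma two_mul_choose_two (m : ℕ) : 2 * (m + 1).choose 2 = m * (m + 1) := by
  have h : 2 ∣ (m + 1) * m := by
    rw [mul_comm]
    exact (Nat.even_mul_succ_self m).two_dvd
  rw [Nat.choose_two_right, Nat.add_sub_cancel, Nat.mul_div_cancel' h, mul_comm]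

/-- Splitting a bilateral series into its nonnegative and negative parts. -/
lemma bilateral_split {f : ℤ → ℂ} {A : ℂ} (h : HasSum f A) {g r : ℕ → ℂ}
    (hg : ∀ n : ℕ, f n = g n) (hr : ∀ m : ℕ, f (-((m : ℤ) + 1)) = r m) :
    Summable g ∧ Summable r ∧ ∑' n, g n + ∑' m, r m = ∑' n, f n := by
  have h1 : Summable g := by
    refine (h.summable.comp_injective (i := ((↑) : ℕ → ℤ)) Nat.cast_injective).congr fun n => ?_
    exact (hg n).symm ▸ rfl
  have h2 : Summable r := by
    refine (h.summable.comp_injective (i := fun m : ℕ => -((m : ℤ) + 1)) fun a b hab => ?_).congr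
      fun n => ?_
    · simpa using hab
    · exact (hr n).symm ▸ rfl
  refine ⟨h1, h2, ?_⟩
  rw [← tsum_congr hg, ← tsum_congr hr]
  refine (tsum_of_nat_of_neg_add_one ?_ ?_).symm
  · exact h1.congr fun n => (hg n).symm
  · exact h2.congr fun n => (hr n).symm

lemma zpow_natCast_sq (q : ℂ) (n : ℕ) : q ^ ((n : ℤ) ^ 2) = q ^ (n ^ 2) := by
  rw [← zpow_natCast]; push_cast; rfl

lemma zpow_neg_natCast_sq (q : ℂ) (m : ℕ) : q ^ ((-((m : ℤ) + 1)) ^ 2) = q ^ ((m + 1) ^ 2) := by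
  rw [neg_sq, ← zpow_natCast]; push_cast; rfl

lemma phi_bilateral {q : ℂ} (hq0 : q ≠ 0) (hq : ‖q‖ < 1) :
    Summable (phiTerm q) ∧ Summable (fun m : ℕ => q ^ (m + 1) * qPoch (-q ^ 2) (q ^ 2) m) ∧
    phi q + 2 * ∑' m : ℕ, q ^ (m + 1) * qPoch (-q ^ 2) (q ^ 2) m =
        ∑' n : ℤ, q ^ (n ^ 2) * qPochInv (-q ^ 2) (q ^ 2) n ∧
    HasSum (fun n : ℤ => q ^ (n ^ 2) * qPochInv (-q ^ 2) (q ^ 2) n)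
      (eulerP (q ^ 2) ^ 7 / (eulerP q ^ 3 * eulerP (q ^ 4) ^ 3)) := by
  have hp0 : q ^ 2 ≠ 0 := pow_ne_zero 2 hq0
  have hp := norm_pow_lt_one hq two_ne_zero
  have hx : qPochInf (-q ^ 2) (q ^ 2) ≠ 0 := qPochInf_ne_zero_of_norm_lt hp (by rwa [norm_neg])
  have h := hasSum_of_eq (hasSum_phi hq0 hq) fun n => by rw [← qPochInv_eq hp0 hp hx]
  obtain ⟨h1, h2, h3⟩ := bilateral_split h (g := phiTerm q)
    (r := fun m => 2 * (q ^ (m + 1) * qPoch (-q ^ 2) (q ^ 2) m))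
    (fun n => by rw [zpow_natCast_sq, qPochInv_natCast, phiTerm]; ring)
    (fun m => by
      have e : q ^ ((m + 1) ^ 2) = q ^ (m + 1) * (q ^ 2) ^ ((m + 1).choose 2) := by
        rw [← pow_mul, two_mul_choose_two, ← pow_add]; ring_nf
      rw [zpow_neg_natCast_sq, e]
      linear_combination q ^ (m + 1) * qPochInv_neg_self hp0 hp m)
  rw [tsum_mul_left] at h3
  exact ⟨h1, (summable_mul_left_iff two_ne_zero).mp h2, h3, h⟩

lemma psi_bilateral {q : ℂ} (hq0 : q ≠ 0) (hq : ‖q‖ < 1) :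
    Summable (psiTerm q) ∧ Summable (fun n : ℕ => (-q ^ 2) ^ n * qPoch q (q ^ 2) n) ∧
    1 + 2 * psi q + q * ∑' n : ℕ, (-q ^ 2) ^ n * qPoch q (q ^ 2) n =
        ∑' n : ℤ, q ^ (n ^ 2) * qPochInv q (q ^ 2) (n + 1) ∧
    HasSum (fun n : ℤ => q ^ (n ^ 2) * qPochInv q (q ^ 2) (n + 1))
      (eulerP (q ^ 2) ^ 7 / (eulerP q ^ 3 * eulerP (q ^ 4) ^ 3)) := by
  have hp0 : q ^ 2 ≠ 0 := pow_ne_zero 2 hq0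
  have hp := norm_pow_lt_one hq two_ne_zero
  have hx : qPochInf q (q ^ 2) ≠ 0 := qPochInf_ne_zero_of_norm_lt hp hq
  have h := hasSum_of_eq (g := fun n : ℤ => q ^ (n ^ 2) * qPochInv q (q ^ 2) (n + 1))
    (hasSum_psi hq0 hq) fun n => by
      rw [qPochInv_eq hp0 hp hx, zpow_add_one₀ hp0]; ring_nf
  set g : ℕ → ℂ := fun n => q ^ (n ^ 2) / qPoch q (q ^ 2) (n + 1) with hg
  obtain ⟨h1, h2, h3⟩ := bilateral_split h (g := g)
    (r := fun m => q * ((-q ^ 2) ^ m * qPoch q (q ^ 2) m))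
    (fun n => by
      have := qPochInv_natCast q (q ^ 2) (n + 1)
      push_cast at this
      rw [zpow_natCast_sq, this]; ring)
    (fun m => by
      rw [zpow_neg_natCast_sq, show -((m : ℤ) + 1) + 1 = -(m : ℤ) by ring, neg_pow (q ^ 2)]
      linear_combination q ^ (2 * m + 1) * qPochInv_odd hq0 hq m)
  set u : ℕ → ℂ := fun n => q ^ (n ^ 2) / qPoch q (q ^ 2) n with hu
  have hP := qPoch_ne_zero (mul_pow_ne_one hp hq)
  -- From 1 = (1 - q^(2n+1)) + q^(2n+1): the nonnegative half is 1 + ψ plus another ψ.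
  have hgu : ∀ n, g n = u n + psiTerm q n := fun n => by
    have e1 := hP n
    have e2 := hP (n + 1)
    simp only [hg, hu, psiTerm]
    rw [qPoch_succ] at e2 ⊢
    have e3 := right_ne_zero_of_mul e2
    field_simp
    ring
  have hs : Summable (psiTerm q) := by
    refine Summable.of_norm_bounded h1.norm fun m => ?_
    have : psiTerm q m = q ^ (2 * m + 1) * g m := by
      simp only [hg, psiTerm]; ring
    rw [this, norm_mul, norm_pow]
    exact mul_le_of_le_one_left (norm_nonneg _) (pow_le_one₀ (norm_nonneg _) hq.le)
  have hsu : Summable u := (h1.sub hs).congr fun n => by rw [hgu]; ring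
  have hu0 : ∑' n, u n = 1 + psi q := by
    rw [hsu.tsum_eq_zero_add]
    simp [hu, psi, psiTerm, qPoch_zero]
  refine ⟨hs, (summable_mul_left_iff hq0).mp h2, ?_, h⟩
  rw [← h3, tsum_congr hgu, hsu.tsum_add hs, hu0, tsum_mul_left]
  simp only [psi]
  ring

lemma f_zero_bilateral {q : ℂ} (hq0 : q ≠ 0) (hq : ‖q‖ < 1) :
    Summable (fZeroTerm q) ∧ Summable (psiZeroTerm q) ∧
    fZero q + 2 * psiZero q = ∑' n : ℤ, q ^ (n ^ 2) * qPochInv (-q) q n ∧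
    HasSum (fun n : ℤ => q ^ (n ^ 2) * qPochInv (-q) q n)
      (eulerP q ^ 2 / eulerP (q ^ 2) * RR 0 q +
        4 * q * (eulerP (q ^ 4) ^ 2 / eulerP (q ^ 2) * RR 1 (q ^ 4))) := by
  have hx : qPochInf (-q) q ≠ 0 := qPochInf_ne_zero_of_norm_lt hq (by rwa [norm_neg])
  have h := hasSum_of_eq (hasSum_f_zero hq0 hq) fun n => by rw [← qPochInv_eq hq0 hq hx]
  obtain ⟨h1, h2, h3⟩ := bilateral_split h (g := fZeroTerm q) (r := fun m => 2 * psiZeroTerm q m)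
    (fun n => by rw [zpow_natCast_sq, qPochInv_natCast, fZeroTerm]; ring)
    (fun m => by
      -- Consecutive triangular numbers add up to a square; the smaller one is used up by the
      -- reflection.
      have e : q ^ ((m + 1) ^ 2) = q ^ ((m + 2).choose 2) * q ^ ((m + 1).choose 2) := by
        rw [← pow_add]
        congr 1
        have h1 := two_mul_choose_two m
        have h2 := two_mul_choose_two (m + 1)
        linarith
      rw [zpow_neg_natCast_sq, e, psiZeroTerm]
      linear_combination q ^ ((m + 2).choose 2) * qPochInv_neg_self hq0 hq m)
  rw [tsum_mul_left] at h3
  exact ⟨h1, (summable_mul_left_iff two_ne_zero).mp h2, h3, h⟩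

lemma f_one_bilateral {q : ℂ} (hq0 : q ≠ 0) (hq : ‖q‖ < 1) :
    Summable (fOneTerm q) ∧ Summable (psiOneTerm q) ∧
    fOne q + 2 * psiOne q = ∑' n : ℤ, q ^ (n ^ 2 + n) * qPochInv (-q) q n ∧
    HasSum (fun n : ℤ => q ^ (n ^ 2 + n) * qPochInv (-q) q n)
      (-(eulerP q ^ 2 / eulerP (q ^ 2) * RR 1 q) +
        4 * (eulerP (q ^ 4) ^ 2 / eulerP (q ^ 2) * RR 0 (q ^ 4))) := by
  have hx : qPochInf (-q) q ≠ 0 := qPochInf_ne_zero_of_norm_lt hq (by rwa [norm_neg])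
  have h := hasSum_of_eq (hasSum_f_one hq0 hq) fun n => by rw [← qPochInv_eq hq0 hq hx]
  obtain ⟨h1, h2, h3⟩ := bilateral_split h (g := fOneTerm q) (r := fun m => 2 * psiOneTerm q m)
    (fun n => by
      rw [qPochInv_natCast, fOneTerm, ← zpow_natCast q (n ^ 2 + n)]
      push_cast
      ring)
    (fun m => by
      have e : q ^ ((-((m : ℤ) + 1)) ^ 2 + -((m : ℤ) + 1)) =
          q ^ ((m + 1).choose 2) * q ^ ((m + 1).choose 2) := by
        rw [← pow_add, ← two_mul, two_mul_choose_two, ← zpow_natCast]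
        congr 1
        push_cast
        ring
      rw [e, psiOneTerm]
      linear_combination q ^ ((m + 1).choose 2) * qPochInv_neg_self hq0 hq m)
  rw [tsum_mul_left] at h3
  exact ⟨h1, (summable_mul_left_iff two_ne_zero).mp h2, h3, h⟩

lemma neg_one_pow_sq (m : ℕ) : (-1 : ℂ) ^ (m ^ 2) = (-1) ^ m := by
  rw [sq, pow_mul]
  rcases Nat.even_or_odd m with h | h
  · rw [h.neg_one_pow, one_pow]
  · rw [h.neg_one_pow, h.neg_one_pow]

lemma F_zero_bilateral {q : ℂ} (hq0 : q ≠ 0) (hq : ‖q‖ < 1) :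
    Summable (FZeroTerm q) ∧ Summable (phiZeroTerm (-q)) ∧
    FZero q + phiZero (-q) - 1 = ∑' n : ℤ, q ^ (2 * n ^ 2) * qPochInv q (q ^ 2) n ∧
    HasSum (fun n : ℤ => q ^ (2 * n ^ 2) * qPochInv q (q ^ 2) n)
      (eulerP (q ^ 4) ^ 6 / (eulerP q * eulerP (q ^ 2) ^ 2 * eulerP (q ^ 8) ^ 2) * RR 0 (q ^ 8) +
        2 * q * (eulerP (q ^ 2) ^ 4 * eulerP (q ^ 8) ^ 4 / (eulerP q * eulerP (q ^ 4) ^ 6) *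
          RR 1 (q ^ 2)) -
        4 * q * (eulerP (q ^ 2) ^ 2 * eulerP (q ^ 8) ^ 6 / (eulerP q * eulerP (q ^ 4) ^ 6) *
          RR 0 (q ^ 8))) := by
  have hp0 : q ^ 2 ≠ 0 := pow_ne_zero 2 hq0
  have hp := norm_pow_lt_one hq two_ne_zero
  have hx : qPochInf q (q ^ 2) ≠ 0 := qPochInf_ne_zero_of_norm_lt hp hq
  have h := hasSum_of_eq (g := fun n : ℤ => q ^ (2 * n ^ 2) * qPochInv q (q ^ 2) n)
    (hasSum_F_zero hq0 hq) fun n => by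
      rw [← qPochInv_eq hp0 hp hx, ← zpow_natCast q 2, ← zpow_mul]; rfl
  obtain ⟨h1, h2, h3⟩ := bilateral_split h (g := FZeroTerm q)
    (r := fun m => phiZeroTerm (-q) (m + 1))
    (fun n => by
      rw [qPochInv_natCast, FZeroTerm, ← zpow_natCast q (2 * n ^ 2)]
      push_cast
      ring)
    (fun m => by
      have e : q ^ (2 * (-((m : ℤ) + 1)) ^ 2) = q ^ ((m + 1) ^ 2) * q ^ ((m + 1) ^ 2) := by
        rw [← pow_add, ← zpow_natCast]
        congr 1
        push_cast
        ring
      have h4 := qPochInv_odd hq0 hq (m + 1)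
      push_cast at h4
      rw [e, phiZeroTerm, neg_pow q, neg_one_pow_sq, neg_neg, neg_sq]
      linear_combination q ^ ((m + 1) ^ 2) * h4)
  -- The negative half gives φ₀(-q) without its term at 0, which is 1; hence the -1 in the identity.
  have h5 := (summable_nat_add_iff 1).mp h2
  refine ⟨h1, h5, ?_, h⟩
  rw [← h3, FZero, phiZero, h5.tsum_eq_zero_add]
  simp only [phiZeroTerm, qPoch_zero]
  ring

lemma F_one_bilateral {q : ℂ} (hq0 : q ≠ 0) (hq : ‖q‖ < 1) :
    Summable (FOneTerm q) ∧ Summable (phiOneTerm (-q)) ∧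
    FOne q - q⁻¹ * phiOne (-q) = ∑' n : ℤ, q ^ (2 * n ^ 2 - 2 * n) * qPochInv q (q ^ 2) n ∧
    HasSum (fun n : ℤ => q ^ (2 * n ^ 2 - 2 * n) * qPochInv q (q ^ 2) n)
      (-(q * (eulerP (q ^ 4) ^ 6 / (eulerP q * eulerP (q ^ 2) ^ 2 * eulerP (q ^ 8) ^ 2) *
          RR 1 (q ^ 8))) +
        2 * (eulerP (q ^ 2) ^ 4 * eulerP (q ^ 8) ^ 4 / (eulerP q * eulerP (q ^ 4) ^ 6) *
          RR 0 (q ^ 2)) +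
        4 * q ^ 2 * (eulerP (q ^ 2) ^ 2 * eulerP (q ^ 8) ^ 6 / (eulerP q * eulerP (q ^ 4) ^ 6) *
          RR 1 (q ^ 8))) := by
  have hp0 : q ^ 2 ≠ 0 := pow_ne_zero 2 hq0
  have hp := norm_pow_lt_one hq two_ne_zero
  have hx : qPochInf q (q ^ 2) ≠ 0 := qPochInf_ne_zero_of_norm_lt hp hq
  set f : ℤ → ℂ := fun n => q ^ (2 * n ^ 2 - 2 * n) * qPochInv q (q ^ 2) n with hf
  -- The shift n ↦ n + 1 turns 2n² - 2n into 2n² + 2n and puts the cut at n ≥ 1, where F₁ begins.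
  have h := hasSum_of_eq (g := fun n : ℤ => f (n + 1)) (hasSum_F_one hq0 hq) fun n => by
      have e : q ^ (2 * (n + 1) ^ 2 - 2 * (n + 1)) = (q ^ 2) ^ (n ^ 2 + n) := by
        rw [← zpow_natCast q 2, ← zpow_mul]
        congr 1
        push_cast
        ring
      simp only [hf]
      rw [qPochInv_eq hp0 hp hx, zpow_add_one₀ hp0, e]
      ring_nf
  have h' := ((Equiv.addRight (1 : ℤ)).hasSum_iff (f := f)).mp h
  obtain ⟨h1, h2, h3⟩ := bilateral_split h (g := FOneTerm q)
    (r := fun m => -q⁻¹ * phiOneTerm (-q) m)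
    (fun n => by
      have h4 := qPochInv_natCast q (q ^ 2) (n + 1)
      push_cast at h4
      have e : q ^ (2 * ((n : ℤ) + 1) ^ 2 - 2 * (n + 1)) = q ^ (2 * n * (n + 1)) := by
        rw [← zpow_natCast]
        congr 1
        push_cast
        ring
      simp only [hf]
      rw [h4, FOneTerm, e]
      ring)
    (fun m => by
      simp only [hf]
      have e : q ^ (2 * (-((m : ℤ) + 1) + 1) ^ 2 - 2 * (-((m : ℤ) + 1) + 1)) =
          q ^ (m ^ 2) * q ^ (m ^ 2 + 2 * m) := by
        rw [← pow_add, ← zpow_natCast]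
        congr 1
        push_cast
        ring
      rw [e, show -((m : ℤ) + 1) + 1 = -(m : ℤ) by ring, phiOneTerm, neg_pow q, neg_one_pow_sq,
        neg_neg, neg_sq, show (m + 1) ^ 2 = m ^ 2 + 2 * m + 1 by ring, pow_succ q (m ^ 2 + 2 * m),
        pow_succ (-1 : ℂ)]
      have h4 := qPochInv_odd hq0 hq m
      field_simp
      linear_combination h4)
  refine ⟨h1, (summable_mul_left_iff (neg_ne_zero.mpr (inv_ne_zero hq0))).mp h2, ?_, h'⟩
  rw [h'.tsum_eq, ← h.tsum_eq, ← h3, tsum_mul_left, FOne, phiOne]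
  ring

/-! ### Translation into eta functions. -/

lemma qPow_pow (τ : ℂ) (r : ℝ) (n : ℕ) : qPow τ r ^ n = qPow τ (n * r) := by
  rw [qPow, qPow, ← Complex.exp_nat_mul]
  congr 1
  push_cast
  ring

lemma qPow_nat_mul (τ : ℂ) (k : ℕ) (r : ℝ) : qPow (k * τ) r = qPow τ (k * r) := by
  rw [qPow, qPow]
  congr 1
  push_cast
  ring

lemma qPow_neg (τ : ℂ) (r : ℝ) : qPow τ (-r) = (qPow τ r)⁻¹ := by
  rw [qPow, qPow, ← Complex.exp_neg]
  congr 1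
  push_cast
  ring

lemma eta_eq (z : ℂ) : eta z = qPow z (1 / 24) * eulerP (qPow z 1) := by
  have h : Function.Periodic.qParam 1 z = qPow z 1 := by
    rw [Function.Periodic.qParam, qPow]
    congr 1
    push_cast
    ring
  rw [eta, eulerP, qPochInf]
  congr 1
  · rw [Function.Periodic.qParam, qPow]
    congr 1
    push_cast
    ring
  · refine tprod_congr fun n => ?_
    rw [ModularForm.eta_q, h, pow_succ']

lemma eta_nat_mul (τ : ℂ) (k : ℕ) :
    eta (k * τ) = qPow τ (1 / 24) ^ k * eulerP (qPow τ 1 ^ k) := by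
  rw [eta_eq, qPow_nat_mul, qPow_nat_mul, qPow_pow, qPow_pow]

lemma genEta_eq (g : ℤ) (z : ℂ) :
    genEta 5 g z = qPow z (5 * bernB (g / 5) / 2) * modTheta (qPow z 1 ^ g) (qPow z 1 ^ 5) := by
  rw [genEta, qPow]
  congr 2
  push_cast
  ring

lemma genEta_one {τ : ℂ} {k : ℕ} (hk : k ≠ 0) (hq : ‖qPow τ 1‖ < 1) :
    genEta 5 1 (k * τ) = qPow τ (1 / 60) ^ k * (RR 0 (qPow τ 1 ^ k))⁻¹ := by
  have h0 : qPow τ 1 ^ k ≠ 0 := pow_ne_zero _ (Complex.exp_ne_zero _)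
  have h1 : qPow (k * τ) 1 = qPow τ 1 ^ k := by rw [qPow_nat_mul, qPow_pow]
  rw [genEta_eq, h1, qPow_nat_mul, rogers_ramanujan_zero h0 (norm_pow_lt_one hq hk),
    inv_inv, zpow_one, qPow_pow τ (1 / 60)]
  congr 2
  -- The exponent is (5/2) B(1/5) = 1/60; for g = 2 it is (5/2) B(2/5) = -11/60.
  norm_num [bernB]

lemma genEta_two {τ : ℂ} {k : ℕ} (hk : k ≠ 0) (hq : ‖qPow τ 1‖ < 1) :
    genEta 5 2 (k * τ) = (qPow τ (11 / 60) ^ k)⁻¹ * (RR 1 (qPow τ 1 ^ k))⁻¹ := by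
  have h0 : qPow τ 1 ^ k ≠ 0 := pow_ne_zero _ (Complex.exp_ne_zero _)
  have h1 : qPow (k * τ) 1 = qPow τ 1 ^ k := by rw [qPow_nat_mul, qPow_pow]
  rw [genEta_eq, h1, qPow_nat_mul, rogers_ramanujan_one h0 (norm_pow_lt_one hq hk),
    inv_inv, qPow_pow τ (11 / 60), ← qPow_neg]
  congr 2
  norm_num [bernB]

lemma RR_zero_ne_zero {q : ℂ} (hq0 : q ≠ 0) (hq : ‖q‖ < 1) : RR 0 q ≠ 0 := by
  rw [rogers_ramanujan_zero hq0 hq, modTheta, show q ^ 5 / q = q ^ 4 by field_simp]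
  have h1 := qPochInf_pow_ne_zero hq (a := 1) (b := 5) (by norm_num) (by norm_num)
  have h2 := qPochInf_pow_ne_zero hq (a := 4) (b := 5) (by norm_num) (by norm_num)
  rw [pow_one] at h1
  exact inv_ne_zero (mul_ne_zero h1 h2)

lemma RR_one_ne_zero {q : ℂ} (hq0 : q ≠ 0) (hq : ‖q‖ < 1) : RR 1 q ≠ 0 := by
  rw [rogers_ramanujan_one hq0 hq, modTheta, show q ^ 5 / q ^ 2 = q ^ 3 by field_simp]
  have h1 := qPochInf_pow_ne_zero hq (a := 2) (b := 5) (by norm_num) (by norm_num)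
  have h2 := qPochInf_pow_ne_zero hq (a := 3) (b := 5) (by norm_num) (by norm_num)
  exact inv_ne_zero (mul_ne_zero h1 h2)

lemma norm_qPow_one_lt {τ : ℂ} (hτ : 0 < τ.im) : ‖qPow τ 1‖ < 1 := by
  rw [qPow, Complex.norm_exp, Real.exp_lt_one_iff]
  have : (2 * Real.pi * Complex.I * (1 : ℝ) * τ).re = -(2 * Real.pi * τ.im) := by
    simp
  rw [this]
  have := Real.pi_pos
  have : 0 < 2 * Real.pi * τ.im := by positivity
  linarith

/-- The number 120 is a common denominator of 1/24, 1/60 and 11/60. With t = q^(1/120) all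
prefactors are integral powers of t, and the final identities become rational identities in t, Euler
products and Rogers–Ramanujan series. -/
lemma eta_eq_pow {τ : ℂ} {k : ℕ} {z : ℂ} (hz : z = k * τ) :
    eta z = qPow τ (1 / 120) ^ (5 * k) * eulerP (qPow τ 1 ^ k) := by
  rw [hz, eta_nat_mul, pow_mul, qPow_pow τ (1 / 120) 5]
  norm_num

lemma genEta_one_eq_pow {τ : ℂ} {k : ℕ} (hk : k ≠ 0) (hq : ‖qPow τ 1‖ < 1) {z : ℂ}
    (hz : z = k * τ) :
    genEta 5 1 z = qPow τ (1 / 120) ^ (2 * k) * (RR 0 (qPow τ 1 ^ k))⁻¹ := by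
  rw [hz, genEta_one hk hq, pow_mul, qPow_pow τ (1 / 120) 2]
  norm_num

lemma genEta_two_eq_pow {τ : ℂ} {k : ℕ} (hk : k ≠ 0) (hq : ‖qPow τ 1‖ < 1) {z : ℂ}
    (hz : z = k * τ) :
    genEta 5 2 z = (qPow τ (1 / 120) ^ (22 * k))⁻¹ * (RR 1 (qPow τ 1 ^ k))⁻¹ := by
  rw [hz, genEta_two hk hq, pow_mul, qPow_pow τ (1 / 120)]
  norm_num

lemma qPow_one_eq (τ : ℂ) : qPow τ 1 = qPow τ (1 / 120) ^ 120 := by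
  rw [qPow_pow]
  norm_num

lemma qPow_ne_zero (τ : ℂ) (r : ℝ) : qPow τ r ≠ 0 := Complex.exp_ne_zero _

lemma third_order_eta {τ : ℂ} (hq : ‖qPow τ 1‖ < 1) :
    qPow τ (1 / 24) * (eta (2 * τ) ^ 7 / (eta τ ^ 3 * eta (4 * τ) ^ 3)) =
      eulerP (qPow τ 1 ^ 2) ^ 7 / (eulerP (qPow τ 1) ^ 3 * eulerP (qPow τ 1 ^ 4) ^ 3) := by
  have ht := qPow_ne_zero τ (1 / 120)
  have h1 := eulerP_ne_zero hq
  have h2 := eulerP_pow_ne_zero hq two_ne_zero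
  have h4 := eulerP_pow_ne_zero hq four_ne_zero
  have h : qPow τ (1 / 24) = qPow τ (1 / 120) ^ 5 := by rw [qPow_pow]; norm_num
  rw [h, eta_eq_pow (τ := τ) (k := 1) (z := τ) (by simp), eta_eq_pow (τ := τ) (k := 2) (z := 2 * τ) (by simp),
    eta_eq_pow (τ := τ) (k := 4) (z := 4 * τ) (by simp), pow_one]
  generalize eulerP _ = A at h1 ⊢
  generalize eulerP _ = A at h2 ⊢
  generalize eulerP _ = A at h4 ⊢
  field_simp
  ring

lemma f_zero_eta {τ : ℂ} (hq : ‖qPow τ 1‖ < 1) :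
    qPow τ (1 / 60) * (eta τ ^ 2 / (eta (2 * τ) * genEta 5 1 τ) +
        4 * (eta (4 * τ) ^ 2 / (eta (2 * τ) * genEta 5 2 (4 * τ)))) =
      eulerP (qPow τ 1) ^ 2 / eulerP (qPow τ 1 ^ 2) * RR 0 (qPow τ 1) +
        4 * qPow τ 1 * (eulerP (qPow τ 1 ^ 4) ^ 2 / eulerP (qPow τ 1 ^ 2) *
          RR 1 (qPow τ 1 ^ 4)) := by
  have ht := qPow_ne_zero τ (1 / 120)
  have h1 := eulerP_ne_zero hq
  have h2 := eulerP_pow_ne_zero hq two_ne_zero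
  have h4 := eulerP_pow_ne_zero hq four_ne_zero
  have h : qPow τ (1 / 60) = qPow τ (1 / 120) ^ 2 := by rw [qPow_pow]; norm_num
  rw [h, eta_eq_pow (τ := τ) (k := 1) (z := τ) (by simp), eta_eq_pow (τ := τ) (k := 2) (z := 2 * τ) (by simp),
    eta_eq_pow (τ := τ) (k := 4) (z := 4 * τ) (by simp),
    genEta_one_eq_pow (τ := τ) (k := 1) one_ne_zero hq (z := τ) (by simp),
    genEta_two_eq_pow (τ := τ) (k := 4) four_ne_zero hq (z := 4 * τ) (by simp), pow_one]
  have hR0 := RR_zero_ne_zero (qPow_ne_zero τ 1) hq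
  have hR1 := RR_one_ne_zero (pow_ne_zero 4 (qPow_ne_zero τ 1)) (norm_pow_lt_one hq four_ne_zero)
  have e := qPow_one_eq τ
  generalize qPow τ (1 / 120) = t at *
  generalize RR 0 _ = R0 at *
  generalize RR 1 _ = R1 at *
  generalize eulerP (qPow τ 1) = E1 at *
  generalize eulerP (qPow τ 1 ^ 2) = E2 at *
  generalize eulerP (qPow τ 1 ^ 4) = E4 at *
  rw [e]
  field_simp
  ring

lemma f_one_eta {τ : ℂ} (hq : ‖qPow τ 1‖ < 1) :
    qPow τ (-11 / 60) * (-(eta τ ^ 2 / (eta (2 * τ) * genEta 5 2 τ)) +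
        4 * (eta (4 * τ) ^ 2 / (eta (2 * τ) * genEta 5 1 (4 * τ)))) =
      -(eulerP (qPow τ 1) ^ 2 / eulerP (qPow τ 1 ^ 2) * RR 1 (qPow τ 1)) +
        4 * (eulerP (qPow τ 1 ^ 4) ^ 2 / eulerP (qPow τ 1 ^ 2) * RR 0 (qPow τ 1 ^ 4)) := by
  have ht := qPow_ne_zero τ (1 / 120)
  have h1 := eulerP_ne_zero hq
  have h2 := eulerP_pow_ne_zero hq two_ne_zero
  have h4 := eulerP_pow_ne_zero hq four_ne_zero
  have h : qPow τ (-11 / 60) = (qPow τ (1 / 120) ^ 22)⁻¹ := by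
    rw [qPow_pow, ← qPow_neg]; norm_num
  rw [h, eta_eq_pow (τ := τ) (k := 1) (z := τ) (by simp), eta_eq_pow (τ := τ) (k := 2) (z := 2 * τ) (by simp),
    eta_eq_pow (τ := τ) (k := 4) (z := 4 * τ) (by simp),
    genEta_two_eq_pow (τ := τ) (k := 1) one_ne_zero hq (z := τ) (by simp),
    genEta_one_eq_pow (τ := τ) (k := 4) four_ne_zero hq (z := 4 * τ) (by simp), pow_one]
  have hR1 := RR_one_ne_zero (qPow_ne_zero τ 1) hq
  have hR0 := RR_zero_ne_zero (pow_ne_zero 4 (qPow_ne_zero τ 1)) (norm_pow_lt_one hq four_ne_zero)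
  generalize qPow τ (1 / 120) = t at *
  generalize RR 0 _ = R0 at *
  generalize RR 1 _ = R1 at *
  generalize eulerP (qPow τ 1) = E1 at *
  generalize eulerP (qPow τ 1 ^ 2) = E2 at *
  generalize eulerP (qPow τ 1 ^ 4) = E4 at *
  field_simp
  ring

lemma F_zero_eta {τ : ℂ} (hq : ‖qPow τ 1‖ < 1) :
    qPow τ (1 / 120) *
        (eta (4 * τ) ^ 6 /
            (eta τ * eta (2 * τ) ^ 2 * eta (8 * τ) ^ 2 * genEta 5 1 (8 * τ)) +
          2 * (eta (2 * τ) ^ 4 * eta (8 * τ) ^ 4 /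
            (eta τ * eta (4 * τ) ^ 6 * genEta 5 2 (2 * τ))) -
          4 * (eta (2 * τ) ^ 2 * eta (8 * τ) ^ 6 /
            (eta τ * eta (4 * τ) ^ 6 * genEta 5 1 (8 * τ)))) =
      eulerP (qPow τ 1 ^ 4) ^ 6 / (eulerP (qPow τ 1) * eulerP (qPow τ 1 ^ 2) ^ 2 *
          eulerP (qPow τ 1 ^ 8) ^ 2) * RR 0 (qPow τ 1 ^ 8) +
        2 * qPow τ 1 * (eulerP (qPow τ 1 ^ 2) ^ 4 * eulerP (qPow τ 1 ^ 8) ^ 4 /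
          (eulerP (qPow τ 1) * eulerP (qPow τ 1 ^ 4) ^ 6) * RR 1 (qPow τ 1 ^ 2)) -
        4 * qPow τ 1 * (eulerP (qPow τ 1 ^ 2) ^ 2 * eulerP (qPow τ 1 ^ 8) ^ 6 /
          (eulerP (qPow τ 1) * eulerP (qPow τ 1 ^ 4) ^ 6) * RR 0 (qPow τ 1 ^ 8)) := by
  have ht := qPow_ne_zero τ (1 / 120)
  have h1 := eulerP_ne_zero hq
  have h2 := eulerP_pow_ne_zero hq two_ne_zero
  have h4 := eulerP_pow_ne_zero hq four_ne_zero
  have h8 := eulerP_pow_ne_zero hq (k := 8) (by norm_num)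
  rw [eta_eq_pow (τ := τ) (k := 1) (z := τ) (by simp), eta_eq_pow (τ := τ) (k := 2) (z := 2 * τ) (by simp),
    eta_eq_pow (τ := τ) (k := 4) (z := 4 * τ) (by simp), eta_eq_pow (τ := τ) (k := 8) (z := 8 * τ) (by simp),
    genEta_two_eq_pow (τ := τ) (k := 2) two_ne_zero hq (z := 2 * τ) (by simp),
    genEta_one_eq_pow (τ := τ) (k := 8) (by norm_num) hq (z := 8 * τ) (by simp), pow_one]
  have hR1 := RR_one_ne_zero (pow_ne_zero 2 (qPow_ne_zero τ 1)) (norm_pow_lt_one hq two_ne_zero)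
  have hR0 := RR_zero_ne_zero (pow_ne_zero 8 (qPow_ne_zero τ 1))
    (norm_pow_lt_one hq (m := 8) (by norm_num))
  have e := qPow_one_eq τ
  generalize qPow τ (1 / 120) = t at *
  generalize RR 0 _ = R0 at *
  generalize RR 1 _ = R1 at *
  generalize eulerP (qPow τ 1) = E1 at *
  generalize eulerP (qPow τ 1 ^ 2) = E2 at *
  generalize eulerP (qPow τ 1 ^ 4) = E4 at *
  generalize eulerP (qPow τ 1 ^ 8) = E8 at *
  rw [e]
  field_simp
  ring

lemma F_one_eta {τ : ℂ} (hq : ‖qPow τ 1‖ < 1) :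
    qPow τ (-71 / 120) *
        (-(eta (4 * τ) ^ 6 /
            (eta τ * eta (2 * τ) ^ 2 * eta (8 * τ) ^ 2 * genEta 5 2 (8 * τ))) +
          2 * (eta (2 * τ) ^ 4 * eta (8 * τ) ^ 4 /
            (eta τ * eta (4 * τ) ^ 6 * genEta 5 1 (2 * τ))) +
          4 * (eta (2 * τ) ^ 2 * eta (8 * τ) ^ 6 /
            (eta τ * eta (4 * τ) ^ 6 * genEta 5 2 (8 * τ)))) =
      -(qPow τ 1 * (eulerP (qPow τ 1 ^ 4) ^ 6 / (eulerP (qPow τ 1) * eulerP (qPow τ 1 ^ 2) ^ 2 *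
          eulerP (qPow τ 1 ^ 8) ^ 2) * RR 1 (qPow τ 1 ^ 8))) +
        2 * (eulerP (qPow τ 1 ^ 2) ^ 4 * eulerP (qPow τ 1 ^ 8) ^ 4 /
          (eulerP (qPow τ 1) * eulerP (qPow τ 1 ^ 4) ^ 6) * RR 0 (qPow τ 1 ^ 2)) +
        4 * qPow τ 1 ^ 2 * (eulerP (qPow τ 1 ^ 2) ^ 2 * eulerP (qPow τ 1 ^ 8) ^ 6 /
          (eulerP (qPow τ 1) * eulerP (qPow τ 1 ^ 4) ^ 6) * RR 1 (qPow τ 1 ^ 8)) := by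
  have ht := qPow_ne_zero τ (1 / 120)
  have h1 := eulerP_ne_zero hq
  have h2 := eulerP_pow_ne_zero hq two_ne_zero
  have h4 := eulerP_pow_ne_zero hq four_ne_zero
  have h8 := eulerP_pow_ne_zero hq (k := 8) (by norm_num)
  have h : qPow τ (-71 / 120) = (qPow τ (1 / 120) ^ 71)⁻¹ := by
    rw [qPow_pow, ← qPow_neg]; norm_num
  rw [h, eta_eq_pow (τ := τ) (k := 1) (z := τ) (by simp), eta_eq_pow (τ := τ) (k := 2) (z := 2 * τ) (by simp),
    eta_eq_pow (τ := τ) (k := 4) (z := 4 * τ) (by simp), eta_eq_pow (τ := τ) (k := 8) (z := 8 * τ) (by simp),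
    genEta_one_eq_pow (τ := τ) (k := 2) two_ne_zero hq (z := 2 * τ) (by simp),
    genEta_two_eq_pow (τ := τ) (k := 8) (by norm_num) hq (z := 8 * τ) (by simp), pow_one]
  have hR0 := RR_zero_ne_zero (pow_ne_zero 2 (qPow_ne_zero τ 1)) (norm_pow_lt_one hq two_ne_zero)
  have hR1 := RR_one_ne_zero (pow_ne_zero 8 (qPow_ne_zero τ 1))
    (norm_pow_lt_one hq (m := 8) (by norm_num))
  have e := qPow_one_eq τ
  generalize qPow τ (1 / 120) = t at *
  generalize RR 0 _ = R0 at *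
  generalize RR 1 _ = R1 at *
  generalize eulerP (qPow τ 1) = E1 at *
  generalize eulerP (qPow τ 1 ^ 2) = E2 at *
  generalize eulerP (qPow τ 1 ^ 4) = E4 at *
  generalize eulerP (qPow τ 1 ^ 8) = E8 at *
  rw [e]
  field_simp
  ring

end MockTheta

theorem mainTheorem12 (τ : ℂ) (hτ : 0 < τ.im) (q : ℂ) (hq : q = qPow τ 1) :
    -- all the one-sided series below converge absolutely
    (Summable (phiTerm q) ∧ Summable (psiTerm q) ∧
      Summable (fun m : ℕ => q ^ (m + 1) * qPoch (-q ^ 2) (q ^ 2) m) ∧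
      Summable (fun n : ℕ => (-q ^ 2) ^ n * qPoch q (q ^ 2) n) ∧
      Summable (fZeroTerm q) ∧ Summable (fOneTerm q) ∧
      Summable (psiZeroTerm q) ∧ Summable (psiOneTerm q) ∧
      Summable (FZeroTerm q) ∧ Summable (FOneTerm q) ∧
      Summable (phiZeroTerm (-q)) ∧ Summable (phiOneTerm (-q))) ∧
    -- third order, first identity (the one-sided sum over n ≥ 1 is written with n = m + 1)
    (phi q + 2 * ∑' m : ℕ, q ^ (m + 1) * qPoch (-q ^ 2) (q ^ 2) m =
        ∑' n : ℤ, q ^ (n ^ 2) * qPochInv (-q ^ 2) (q ^ 2) n ∧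
      HasSum (fun n : ℤ => q ^ (n ^ 2) * qPochInv (-q ^ 2) (q ^ 2) n)
        (qPow τ (1 / 24) * (eta (2 * τ) ^ 7 / (eta τ ^ 3 * eta (4 * τ) ^ 3)))) ∧
    -- third order, second identity
    (1 + 2 * psi q + q * ∑' n : ℕ, (-q ^ 2) ^ n * qPoch q (q ^ 2) n =
        ∑' n : ℤ, q ^ (n ^ 2) * qPochInv q (q ^ 2) (n + 1) ∧
      HasSum (fun n : ℤ => q ^ (n ^ 2) * qPochInv q (q ^ 2) (n + 1))
        (qPow τ (1 / 24) * (eta (2 * τ) ^ 7 / (eta τ ^ 3 * eta (4 * τ) ^ 3)))) ∧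
    -- fifth order, f₀ and ψ₀
    (fZero q + 2 * psiZero q = ∑' n : ℤ, q ^ (n ^ 2) * qPochInv (-q) q n ∧
      HasSum (fun n : ℤ => q ^ (n ^ 2) * qPochInv (-q) q n)
        (qPow τ (1 / 60) *
          (eta τ ^ 2 / (eta (2 * τ) * genEta 5 1 τ) +
            4 * (eta (4 * τ) ^ 2 / (eta (2 * τ) * genEta 5 2 (4 * τ)))))) ∧
    -- fifth order, f₁ and ψ₁
    (fOne q + 2 * psiOne q = ∑' n : ℤ, q ^ (n ^ 2 + n) * qPochInv (-q) q n ∧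
      HasSum (fun n : ℤ => q ^ (n ^ 2 + n) * qPochInv (-q) q n)
        (qPow τ (-11 / 60) *
          (-(eta τ ^ 2 / (eta (2 * τ) * genEta 5 2 τ)) +
            4 * (eta (4 * τ) ^ 2 / (eta (2 * τ) * genEta 5 1 (4 * τ)))))) ∧
    -- fifth order, F₀ and φ₀
    (FZero q + phiZero (-q) - 1 = ∑' n : ℤ, q ^ (2 * n ^ 2) * qPochInv q (q ^ 2) n ∧
      HasSum (fun n : ℤ => q ^ (2 * n ^ 2) * qPochInv q (q ^ 2) n)
        (qPow τ (1 / 120) *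
          (eta (4 * τ) ^ 6 /
              (eta τ * eta (2 * τ) ^ 2 * eta (8 * τ) ^ 2 * genEta 5 1 (8 * τ)) +
            2 * (eta (2 * τ) ^ 4 * eta (8 * τ) ^ 4 /
              (eta τ * eta (4 * τ) ^ 6 * genEta 5 2 (2 * τ))) -
            4 * (eta (2 * τ) ^ 2 * eta (8 * τ) ^ 6 /
              (eta τ * eta (4 * τ) ^ 6 * genEta 5 1 (8 * τ)))))) ∧
    -- fifth order, F₁ and φ₁
    (FOne q - q⁻¹ * phiOne (-q) =
        ∑' n : ℤ, q ^ (2 * n ^ 2 - 2 * n) * qPochInv q (q ^ 2) n ∧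
      HasSum (fun n : ℤ => q ^ (2 * n ^ 2 - 2 * n) * qPochInv q (q ^ 2) n)
        (qPow τ (-71 / 120) *
          (-(eta (4 * τ) ^ 6 /
              (eta τ * eta (2 * τ) ^ 2 * eta (8 * τ) ^ 2 * genEta 5 2 (8 * τ))) +
            2 * (eta (2 * τ) ^ 4 * eta (8 * τ) ^ 4 /
              (eta τ * eta (4 * τ) ^ 6 * genEta 5 1 (2 * τ))) +
            4 * (eta (2 * τ) ^ 2 * eta (8 * τ) ^ 6 /
              (eta τ * eta (4 * τ) ^ 6 * genEta 5 2 (8 * τ)))))) := by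
  subst hq
  have hq := norm_qPow_one_lt hτ
  have hq0 : qPow τ 1 ≠ 0 := Complex.exp_ne_zero _
  obtain ⟨a1, a2, a3, a4⟩ := phi_bilateral hq0 hq
  obtain ⟨b1, b2, b3, b4⟩ := psi_bilateral hq0 hq
  obtain ⟨c1, c2, c3, c4⟩ := f_zero_bilateral hq0 hq
  obtain ⟨d1, d2, d3, d4⟩ := f_one_bilateral hq0 hq
  obtain ⟨e1, e2, e3, e4⟩ := F_zero_bilateral hq0 hq
  obtain ⟨g1, g2, g3, g4⟩ := F_one_bilateral hq0 hq
  refine ⟨⟨a1, b1, a2, b2, c1, d1, c2, d2, e1, g1, e2, g2⟩, ⟨a3, hasSum_of_value a4 ?_⟩,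
    ⟨b3, hasSum_of_value b4 ?_⟩, ⟨c3, hasSum_of_value c4 ?_⟩, ⟨d3, hasSum_of_value d4 ?_⟩,
    ⟨e3, hasSum_of_value e4 ?_⟩, ⟨g3, hasSum_of_value g4 ?_⟩⟩
  · exact third_order_eta hq
  · exact third_order_eta hq
  · exact f_zero_eta hq
  · exact f_one_eta hq
  · exact F_zero_eta hq
  · exact F_one_eta hq
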